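/- Let $a\in\mathbb{R}\setminus\{0\}$ and let $D=\frac1i\frac{d}{dx}$. On $L^2(\mathbb{R})$ let $T=D^2+x^2$ with $\operatorname{Dom}(T)=\{f\in W^{2,2}(\mathbb{R}) : x^2f\in L^2(\mathbb{R})\}$, let $L=T+2iax=-\frac{d^2}{dx^2}+x^2+2iax$ and $\tilde L=T+2iaD=-\frac{d^2}{dx^2}+x^2+2a\frac{d}{dx}$, both with domain $\operatorname{Dom}(T)$. Let $A$ be either $L$ or $\tilde L$. For every $k=0,1,2,\dots$ the number $\lambda_k=1+2k+a^2$ is an algebraically simple eigenvalue of $A$ and an isolated point of its spectrum; let $$P_k=\frac1{2\pi i}\int_{|\zeta-\lambda_k|=\varepsilon}(\zeta-A)^{-1}\,d\zeta$$ be the corresponding (rank-one) spectral projection, where $\varepsilon>0$ is smaller than the distance from $\lambda_k$ to every other point of the spectrum of $A$ (the integral does not depend on $\varepsilon$). Then, in operator norm on $L^2(\mathbb{R})$, $$\|P_k\|=\frac{1}{2(2k)^{1/4}\sqrt{|a|\pi}}\exp\left(2^{3/2}|a|\sqrt{k}\right)\left(1+\mathcal{O}(k^{-1/2})\right),\qquad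 k\to\infty,$$ where the implied constant may depend on $a$, and $$\lim_{k\to\infty}\frac1{\sqrt k}\log\|P_k\|=2^{3/2}|a|.$$ -/

import Mathlib

open MeasureTheory Filter Topology Asymptotics
open scoped ContDiff Real

noncomputable section

namespace NSAOsc

/-! ## Unbounded operators: natural compositions, resolvents, spectral projections -/

section Abstract

variable {E : Type*} [NormedAddCommGroup E] [NormedSpace ℂ E]

/-- The product `S R` of two unbounded operators, on its natural domain
`{f ∈ Dom R : R f ∈ Dom S}`. -/
def opComp (S R : E →ₗ.[ℂ] E) : E →ₗ.[ℂ] E where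
  domain :=
    { carrier := {f | ∃ hf : f ∈ R.domain, R ⟨f, hf⟩ ∈ S.domain}
      zero_mem' := ⟨R.domain.zero_mem, by
        have h : R ⟨0, R.domain.zero_mem⟩ = 0 := R.map_zero
        rw [h]; exact S.domain.zero_mem⟩
      add_mem' := by
        rintro f g ⟨hf, hf'⟩ ⟨hg, hg'⟩
        refine ⟨R.domain.add_mem hf hg, ?_⟩
        have h : R ⟨f + g, R.domain.add_mem hf hg⟩ = R ⟨f, hf⟩ + R ⟨g, hg⟩ :=
          R.map_add ⟨f, hf⟩ ⟨g, hg⟩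
        rw [h]; exact S.domain.add_mem hf' hg'
      smul_mem' := by
        rintro c f ⟨hf, hf'⟩
        refine ⟨R.domain.smul_mem c hf, ?_⟩
        have h : R ⟨c • f, R.domain.smul_mem c hf⟩ = c • R ⟨f, hf⟩ := R.map_smul c ⟨f, hf⟩
        rw [h]; exact S.domain.smul_mem c hf' }
  toFun :=
    { toFun := fun f => S ⟨R ⟨f.1, f.2.1⟩, f.2.2⟩
      map_add' := by
        rintro ⟨f, hf, hf'⟩ ⟨g, hg, hg'⟩
        have h : R ⟨f + g, R.domain.add_mem hf hg⟩ = R ⟨f, hf⟩ + R ⟨g, hg⟩ :=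
          R.map_add ⟨f, hf⟩ ⟨g, hg⟩
        rw [← S.map_add]
        exact congrArg S (Subtype.ext h)
      map_smul' := by
        rintro c ⟨f, hf, hf'⟩
        have h : R ⟨c • f, R.domain.smul_mem c hf⟩ = c • R ⟨f, hf⟩ := R.map_smul c ⟨f, hf⟩
        rw [RingHom.id_apply, ← S.map_smul]
        exact congrArg S (Subtype.ext h) }

/-- `R` is the bounded two-sided inverse `(ζ - A)⁻¹` of the unbounded operator `ζ - A`. -/
def IsResolventAt (A : E →ₗ.[ℂ] E) (ζ : ℂ) (R : E →L[ℂ] E) : Prop :=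
  (∀ u : E, ∃ h : R u ∈ A.domain, ζ • R u - A ⟨R u, h⟩ = u) ∧
    ∀ f : A.domain, R (ζ • (f : E) - A f) = f

theorem IsResolventAt.unique {A : E →ₗ.[ℂ] E} {ζ : ℂ} {R S : E →L[ℂ] E}
    (hR : IsResolventAt A ζ R) (hS : IsResolventAt A ζ S) : R = S := by
  ext u
  obtain ⟨h, hu⟩ := hR.1 u
  have := hS.2 ⟨R u, h⟩
  rw [hu] at this
  exact this.symm

/-- The spectrum of an unbounded operator: the points `ζ` where `ζ - A` has no bounded inverse. -/
def opSpectrum (A : E →ₗ.[ℂ] E) : Set ℂ := {ζ | ¬ ∃ R, IsResolventAt A ζ R}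

open Classical in
/-- The resolvent `(ζ - A)⁻¹` (with value `0` on the spectrum). -/
def opResolvent (A : E →ₗ.[ℂ] E) (ζ : ℂ) : E →L[ℂ] E :=
  if h : ∃ R, IsResolventAt A ζ R then h.choose else 0

/-- The Cauchy integral `(2πi)⁻¹ ∮_{|ζ - μ| = ε} (ζ - A)⁻¹ dζ`. -/
def cauchyProjection (A : E →ₗ.[ℂ] E) (μ : ℂ) (ε : ℝ) : E →L[ℂ] E :=
  (2 * π * Complex.I)⁻¹ • ∮ ζ in C(μ, ε), opResolvent A ζ

/-- `P` is the spectral projection of `A` at `μ`: the Cauchy integral of the resolvent over a circle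
around `μ` whose radius is smaller than the distance to every other point of the spectrum. -/
def IsSpectralProjection (A : E →ₗ.[ℂ] E) (μ : ℂ) (P : E →L[ℂ] E) : Prop :=
  ∃ ε : ℝ, 0 < ε ∧ (∀ ν ∈ opSpectrum A, ν ≠ μ → ε < dist ν μ) ∧ P = cauchyProjection A μ ε

/-- `μ` is an eigenvalue of `A`. -/
def IsEigenvalue (A : E →ₗ.[ℂ] E) (μ : ℂ) : Prop :=
  ∃ f : A.domain, (f : E) ≠ 0 ∧ A f = μ • (f : E)

end Abstract

/-! ## Operators on `L²(ℝ)` -/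

/-- The Hilbert space `L²(ℝ)` of complex-valued functions. -/
abbrev L2R : Type := Lp ℂ 2 (volume : Measure ℝ)

/-- `g` is the weak (distributional) derivative of `f`. -/
def HasWeakDeriv (f g : L2R) : Prop :=
  ∀ φ : ℝ → ℝ, ContDiff ℝ ∞ φ → HasCompactSupport φ →
    ∫ x, deriv φ x • f x = - ∫ x, φ x • g x

theorem locallyIntegrable_L2R (f : L2R) : LocallyIntegrable f volume :=
  (Lp.memLp f).locallyIntegrable (by norm_num)

theorem integrable_test {φ : ℝ → ℝ} (h : Continuous φ) (hc : HasCompactSupport φ) (f : L2R) :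
    Integrable (fun x => φ x • f x) volume :=
  (locallyIntegrable_L2R f).integrable_smul_left_of_hasCompactSupport h hc

theorem integrable_deriv_test {φ : ℝ → ℝ} (h : ContDiff ℝ ∞ φ) (hc : HasCompactSupport φ)
    (f : L2R) : Integrable (fun x => deriv φ x • f x) volume :=
  integrable_test (h.continuous_deriv (by simp)) hc.deriv f

theorem HasWeakDeriv.unique {f g g' : L2R} (h : HasWeakDeriv f g) (h' : HasWeakDeriv f g') :
    g = g' := by
  refine Lp.ext (ae_eq_of_integral_contDiff_smul_eq (locallyIntegrable_L2R g)
    (locallyIntegrable_L2R g') fun φ hφ hc => ?_)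
  exact neg_injective ((h φ hφ hc).symm.trans (h' φ hφ hc))

theorem HasWeakDeriv.zero : HasWeakDeriv 0 0 := by
  intro φ hφ hc
  have h0 : ((0 : L2R) : ℝ → ℂ) =ᵐ[volume] 0 := Lp.coeFn_zero ℂ 2 volume
  have h1 : ∫ x, deriv φ x • (0 : L2R) x = 0 := by
    rw [integral_eq_zero_of_ae]
    filter_upwards [h0] with x hx
    rw [hx, Pi.zero_apply, smul_zero]
  have h2 : ∫ x, φ x • (0 : L2R) x = 0 := by
    rw [integral_eq_zero_of_ae]
    filter_upwards [h0] with x hx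
    rw [hx, Pi.zero_apply, smul_zero]
  rw [h1, h2, neg_zero]

theorem HasWeakDeriv.add {f g f' g' : L2R} (h : HasWeakDeriv f g) (h' : HasWeakDeriv f' g') :
    HasWeakDeriv (f + f') (g + g') := by
  intro φ hφ hc
  have h1 : ∫ x, deriv φ x • (f + f') x = ∫ x, (deriv φ x • f x + deriv φ x • f' x) := by
    refine integral_congr_ae ?_
    filter_upwards [Lp.coeFn_add f f'] with x hx
    rw [hx, Pi.add_apply, smul_add]
  have h2 : ∫ x, φ x • (g + g') x = ∫ x, (φ x • g x + φ x • g' x) := by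
    refine integral_congr_ae ?_
    filter_upwards [Lp.coeFn_add g g'] with x hx
    rw [hx, Pi.add_apply, smul_add]
  rw [h1, h2, integral_add (integrable_deriv_test hφ hc f) (integrable_deriv_test hφ hc f'),
    integral_add (integrable_test hφ.continuous hc g) (integrable_test hφ.continuous hc g'),
    h φ hφ hc, h' φ hφ hc, neg_add]

theorem HasWeakDeriv.smul {f g : L2R} (c : ℂ) (h : HasWeakDeriv f g) :
    HasWeakDeriv (c • f) (c • g) := by
  intro φ hφ hc
  have h1 : ∫ x, deriv φ x • (c • f) x = ∫ x, c • (deriv φ x • f x) := by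
    refine integral_congr_ae ?_
    filter_upwards [Lp.coeFn_smul c f] with x hx
    rw [hx, Pi.smul_apply, smul_comm]
  have h2 : ∫ x, φ x • (c • g) x = ∫ x, c • (φ x • g x) := by
    refine integral_congr_ae ?_
    filter_upwards [Lp.coeFn_smul c g] with x hx
    rw [hx, Pi.smul_apply, smul_comm]
  rw [h1, h2, integral_smul, integral_smul, h φ hφ hc, smul_neg]

/-- The operator `d/dx` on `L²(ℝ)`, with domain `W^{1,2}(ℝ)`. -/
def weakDeriv : L2R →ₗ.[ℂ] L2R where
  domain :=
    { carrier := {f | ∃ g, HasWeakDeriv f g}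
      zero_mem' := ⟨0, HasWeakDeriv.zero⟩
      add_mem' := by
        rintro f f' ⟨g, hg⟩ ⟨g', hg'⟩
        exact ⟨g + g', hg.add hg'⟩
      smul_mem' := by
        rintro c f ⟨g, hg⟩
        exact ⟨c • g, hg.smul c⟩ }
  toFun :=
    { toFun := fun f => f.2.choose
      map_add' := fun f f' =>
        (f + f').2.choose_spec.unique (f.2.choose_spec.add f'.2.choose_spec)
      map_smul' := fun c f =>
        (c • f).2.choose_spec.unique (f.2.choose_spec.smul c) }

/-- The operator of multiplication by the function `m`, with domain `{f ∈ L² : m f ∈ L²}`. -/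
def mulOp (m : ℝ → ℂ) : L2R →ₗ.[ℂ] L2R where
  domain :=
    { carrier := {f | MemLp (fun x => m x * f x) 2 volume}
      zero_mem' := by
        refine (memLp_congr_ae ?_).mpr (Lp.memLp (0 : L2R))
        filter_upwards [Lp.coeFn_zero ℂ 2 (volume : Measure ℝ)] with x hx
        rw [hx, Pi.zero_apply, mul_zero]
      add_mem' := by
        intro f g hf hg
        refine (memLp_congr_ae ?_).mpr (MemLp.add hf hg)
        filter_upwards [Lp.coeFn_add f g] with x hx
        rw [Pi.add_apply, ← mul_add, ← Pi.add_apply, ← hx]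
      smul_mem' := by
        intro c f hf
        refine (memLp_congr_ae ?_).mpr (MemLp.const_smul hf c)
        filter_upwards [Lp.coeFn_smul c f] with x hx
        simp [hx, mul_left_comm] }
  toFun :=
    { toFun := fun f => MemLp.toLp (fun x => m x * f.1 x) f.2
      map_add' := by
        rintro ⟨f, hf⟩ ⟨g, hg⟩
        rw [← MemLp.toLp_add]
        refine MemLp.toLp_congr _ _ ?_
        filter_upwards [Lp.coeFn_add f g] with x hx
        change m x * (f + g) x = _
        rw [Pi.add_apply, ← mul_add, ← Pi.add_apply, ← hx]
      map_smul' := by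
        rintro c ⟨f, hf⟩
        rw [RingHom.id_apply, ← MemLp.toLp_const_smul]
        refine MemLp.toLp_congr _ _ ?_
        filter_upwards [Lp.coeFn_smul c f] with x hx
        simp [hx, mul_left_comm] }

/-- `D = (1/i) d/dx`, with domain `W^{1,2}(ℝ)`. -/
def opD : L2R →ₗ.[ℂ] L2R := (1 / Complex.I) • weakDeriv

/-- The harmonic oscillator `T = D² + x²`, with domain `{f ∈ W^{2,2}(ℝ) : x² f ∈ L²(ℝ)}`. -/
def oscT : L2R →ₗ.[ℂ] L2R := opComp opD opD + mulOp (fun x => (x : ℂ) ^ 2)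

/-- `L = T + B`, where `B` is multiplication by `2iax`. -/
def oscL (a : ℝ) : L2R →ₗ.[ℂ] L2R :=
  oscT + mulOp (fun x => 2 * Complex.I * (a : ℂ) * (x : ℂ))

/-- `L̃ = T + 2iaD`. -/
def oscLTilde (a : ℝ) : L2R →ₗ.[ℂ] L2R :=
  oscT + (2 * Complex.I * (a : ℂ)) • opD

/-- The perturbation does not change the domain: `Dom L = Dom T`. -/
theorem oscL_domain (a : ℝ) : (oscL a).domain = oscT.domain := by
  refine inf_eq_left.mpr fun f hf => ?_
  have h2 : MemLp (fun x : ℝ => (x : ℂ) ^ 2 * f x) 2 volume := hf.2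
  have h0 : MemLp (fun x : ℝ => f x) 2 volume := Lp.memLp f
  change MemLp (fun x : ℝ => 2 * Complex.I * (a : ℂ) * (x : ℂ) * f x) 2 volume
  have hs : MemLp (fun x : ℝ => (x : ℂ) * f x) 2 volume := by
    refine MemLp.of_le (h0.norm.add h2.norm)
      ((Complex.continuous_ofReal.aestronglyMeasurable).mul h0.1) (ae_of_all _ fun x => ?_)
    have hp := norm_nonneg (f x)
    have hsum : ‖f x‖ + ‖(x : ℂ) ^ 2 * f x‖ ≤
        ‖((fun x => ‖f x‖) + fun x : ℝ => ‖(x : ℂ) ^ 2 * f x‖) x‖ := le_abs_self _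
    refine le_trans ?_ hsum
    rw [norm_mul, norm_mul, norm_pow, Complex.norm_real]
    nlinarith [mul_nonneg hp (sq_nonneg (‖x‖ - 1)), mul_nonneg hp (sq_nonneg ‖x‖)]
  refine (hs.const_mul (2 * Complex.I * (a : ℂ))).congr_norm ?_ (ae_of_all _ fun x => ?_)
  · exact (hs.const_mul (2 * Complex.I * (a : ℂ))).1.congr
      (ae_of_all _ fun x => by simp only; ring)
  · simp only [mul_assoc]

/-- The perturbation does not change the domain: `Dom L̃ = Dom T`. -/
theorem oscLTilde_domain (a : ℝ) : (oscLTilde a).domain = oscT.domain :=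
  inf_eq_left.mpr fun _ hf => hf.1.1

/-- The eigenvalue `λ_k = 1 + 2k + a²`. -/
def eigenval (a : ℝ) (k : ℕ) : ℂ := 1 + 2 * (k : ℂ) + (a : ℂ) ^ 2

end NSAOsc

end

namespace NSAOsc

/-! ### Spectral projections of operators with compact inverse and a biorthogonal eigensystem -/

section Abstract

variable {E : Type*} [NormedAddCommGroup E] [NormedSpace ℂ E]

/-! Both operators belong to the family `-f'' + x²f + 2iαxf + 2βf'`, with `(α, β)` equal to `(a, 0)`
or `(0, a)`. Completing the square shows that `H_k(x + iα) exp(-x²/2 + (β - iα)x)` is an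
eigenfunction with eigenvalue `1 + 2k + α² + β²`. The formal adjoint has parameters `(-α, -β)`, so
its eigenfunctions form a biorthogonal dual family. Both families are total, because a function
whose product with a Gaussian has vanishing moments is zero.

Spectral theory. An a priori estimate on polynomials times Gaussians, together with density of the
range, yields a bounded inverse `K` (`exists_inverse`). For `α = β = 0` the inverse is diagonal in
the Hermite basis with entries tending to zero, hence compact; for general parameters `K` is that
compact inverse composed with the bounded operator `T K`. Splitting off the `k`-th eigenvector
writes the resolvent as `(ζ - λ_k)⁻¹ P` minus a function holomorphic near `λ_k`
(`resolvent_formula`), so the Cauchy integral is the rank-one operator `P = φ_k ⊗ ψ_k`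
(`cauchyProjection_eq`).

Exact norm. `‖P_k‖` is the product of the norms of the eigenfunction and its dual divided by their
pairing. The three are Gaussian integrals of products of shifted Hermite polynomials, and they give
`‖P_k‖ = exp(a²) L_k(-2a²)` with `L_k` the Laguerre polynomial (`norm_proj_eigFun`).

Asymptotics. With `y = 2a²`, `L_n(-y)` is a Fourier coefficient, written as an integral over the
circle with a free scale. Choosing the scale so that the exponent becomes `2√(ny) cos θ` to leading
order compares `L_n(-y)` with `exp(-y/2) I₀(2√(ny))` (`abs_laguerreNeg_sub_le`), and Laplace's
method gives `I₀(r) ~ e^r / √(2πr)` (`exists_abs_besselInt_sub_le`). Both relative errors are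
`O(n^{-1/2})`; the logarithmic limit follows by taking logarithms. -/

theorem opResolvent_eq {A : E →ₗ.[ℂ] E} {ζ : ℂ} {R : E →L[ℂ] E} (h : IsResolventAt A ζ R) :
    opResolvent A ζ = R := by
  have h' : ∃ R, IsResolventAt A ζ R := ⟨R, h⟩
  rw [opResolvent, dif_pos h']
  exact h'.choose_spec.unique h

/-- A bounded two-sided inverse `K` of `A`. -/
def IsInverseOf (K : E →L[ℂ] E) (A : E →ₗ.[ℂ] E) : Prop :=
  (∀ u : E, ∃ h : K u ∈ A.domain, A ⟨K u, h⟩ = u) ∧ ∀ f : A.domain, K (A f) = f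

/-- On the domain, `ζ - A = -(1 - ζK)A`, so inverting `ζ - A` reduces to inverting the bounded
operator `1 - ζK`. The two one-sided identities are compatible because `K` commutes with `1 - ζK`
and hence with its inverse. -/
theorem IsInverseOf.isResolventAt {A : E →ₗ.[ℂ] E} {K U : E →L[ℂ] E} (hK : IsInverseOf K A) {ζ : ℂ}
    (hl : U * (1 - ζ • K) = 1) (hr : (1 - ζ • K) * U = 1) : IsResolventAt A ζ (-(K * U)) := by
  have hc : (K * U) = U * K := by
    have h1 : K * (1 - ζ • K) = (1 - ζ • K) * K := by
      rw [mul_sub, sub_mul, mul_one, one_mul, mul_smul_comm, smul_mul_assoc]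
    calc K * U = (U * (1 - ζ • K)) * K * U := by rw [hl, one_mul]
      _ = U * (K * (1 - ζ • K)) * U := by rw [h1]; simp only [mul_assoc]
      _ = U * K * ((1 - ζ • K) * U) := by simp only [mul_assoc]
      _ = U * K := by rw [hr, mul_one]
  constructor
  · intro u
    obtain ⟨h, hu⟩ := hK.1 (U u)
    have h' : (-(K * U)) u ∈ A.domain := A.domain.neg_mem h
    refine ⟨h', ?_⟩
    have e : A ⟨(-(K * U)) u, h'⟩ = - A ⟨K (U u), h⟩ := A.map_neg ⟨K (U u), h⟩
    rw [e, hu]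
    have := congrArg (fun T : E →L[ℂ] E => T u) hr
    simp at this
    simp
    rw [← sub_eq_neg_add]
    exact this
  · intro f
    have := congrArg (fun T : E →L[ℂ] E => T (f : E)) hl
    simp at this
    rw [hc]
    change -(U (K (ζ • (f : E) - A f))) = f
    rw [map_sub, map_smul, hK.2 f, map_sub, map_smul, neg_sub]
    exact this

/-- The Fredholm alternative: a nonzero `ζ⁻¹` outside the resolvent set of a compact operator is an
eigenvalue, which injectivity excludes. -/
theorem isUnit_one_sub_smul [CompleteSpace E] {K : E →L[ℂ] E} (hK : IsCompactOperator K) (ζ : ℂ)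
    (hinj : ∀ f, f = ζ • K f → f = 0) : IsUnit (1 - ζ • K) := by
  by_cases hζ : ζ = 0
  · simp [hζ]
  have hμ : ζ⁻¹ ≠ 0 := inv_ne_zero hζ
  rcases hK.hasEigenvalue_or_mem_resolventSet hμ with h | h
  · exfalso
    obtain ⟨f, hf⟩ := h.exists_hasEigenvector
    have h1 : K f = ζ⁻¹ • f := hf.apply_eq_smul
    exact hf.2 (hinj f (by rw [h1, smul_inv_smul₀ hζ]))
  · rw [spectrum.mem_resolventSet_iff] at h
    have h2 : 1 - ζ • K = (algebraMap ℂ (E →L[ℂ] E) ζ) * (algebraMap ℂ (E →L[ℂ] E) ζ⁻¹ - K) := by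
      rw [mul_sub, ← map_mul, mul_inv_cancel₀ hζ, map_one, Algebra.smul_def]
    rw [h2]
    exact ((IsUnit.mk0 ζ hζ).map _).mul h

theorem isCompactOperator_smulRight {E F : Type*} [NormedAddCommGroup E] [NormedSpace ℂ E]
    [NormedAddCommGroup F] [NormedSpace ℂ F] (φ : E →L[ℂ] ℂ) (v : F) :
    IsCompactOperator (φ.smulRight v) := by
  refine ⟨_, (isCompact_closedBall (0 : ℂ) 1).image (f := fun c : ℂ => c • v) (by fun_prop), ?_⟩
  filter_upwards [(φ.continuous.tendsto 0).eventually
    (by rw [map_zero]; exact Metric.closedBall_mem_nhds (0 : ℂ) one_pos)] with x hx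
  exact ⟨φ x, hx, rfl⟩

/-- An operator with compact inverse `K` and eigenvalues `lam j`, whose eigenvectors `ψ j` have
a total biorthogonal sequence `φ j` of dual eigenfunctionals. -/
structure BiorthogonalSystem (A : E →ₗ.[ℂ] E) (K : E →L[ℂ] E) (ψ : ℕ → E) (φ : ℕ → E →L[ℂ] ℂ)
    (lam : ℕ → ℂ) : Prop where
  isInverse : IsInverseOf K A
  compact : IsCompactOperator K
  lam_injective : Function.Injective lam
  lam_ne_zero : ∀ j, lam j ≠ 0
  eigenvector : ∀ j, ∃ h : ψ j ∈ A.domain, A ⟨ψ j, h⟩ = lam j • ψ j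
  dual_eigenvector : ∀ j (f : A.domain), φ j (A f) = lam j * φ j f
  biorthogonal : ∀ j k, φ j (ψ k) = if j = k then 1 else 0
  total : ∀ f, (∀ j, φ j f = 0) → f = 0

namespace BiorthogonalSystem

variable {A : E →ₗ.[ℂ] E} {K : E →L[ℂ] E} {ψ : ℕ → E} {φ : ℕ → E →L[ℂ] ℂ} {lam : ℕ → ℂ}

theorem ne_zero (h : BiorthogonalSystem A K ψ φ lam) (j : ℕ) : ψ j ≠ 0 := by
  intro h0
  have := h.biorthogonal j j
  simp [h0] at this

theorem inverse_eigenvector (h : BiorthogonalSystem A K ψ φ lam) (j : ℕ) :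
    K (ψ j) = (lam j)⁻¹ • ψ j := by
  obtain ⟨hd, he⟩ := h.eigenvector j
  have := h.isInverse.2 ⟨ψ j, hd⟩
  rw [he, map_smul] at this
  rw [eq_inv_smul_iff₀ (h.lam_ne_zero j), this]

theorem dual_inverse (h : BiorthogonalSystem A K ψ φ lam) (j : ℕ) (f : E) :
    φ j (K f) = (lam j)⁻¹ * φ j f := by
  obtain ⟨hd, he⟩ := h.isInverse.1 f
  have := h.dual_eigenvector j ⟨K f, hd⟩
  rw [he] at this
  rw [this, inv_mul_cancel_left₀ (h.lam_ne_zero j)]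

theorem isEigenvalue (h : BiorthogonalSystem A K ψ φ lam) (j : ℕ) : IsEigenvalue A (lam j) := by
  obtain ⟨hd, he⟩ := h.eigenvector j
  exact ⟨⟨ψ j, hd⟩, h.ne_zero j, he⟩

/-- The rank-one projection `φ k ⊗ ψ k`. -/
noncomputable def proj (ψ : ℕ → E) (φ : ℕ → E →L[ℂ] ℂ) (k : ℕ) : E →L[ℂ] E := (φ k).smulRight (ψ k)

theorem mem_spectrum (h : BiorthogonalSystem A K ψ φ lam) (j : ℕ) : lam j ∈ opSpectrum A := by
  rintro ⟨R, hR⟩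
  obtain ⟨hd, he⟩ := h.eigenvector j
  have := hR.2 ⟨ψ j, hd⟩
  rw [he, sub_self, map_zero] at this
  exact h.ne_zero j this.symm

theorem finrank_range_proj (h : BiorthogonalSystem A K ψ φ lam) (k : ℕ) :
    Module.finrank ℂ (proj ψ φ k).range = 1 := by
  have : (proj ψ φ k).range = Submodule.span ℂ {ψ k} := by
    ext x
    rw [Submodule.mem_span_singleton]
    constructor
    · rintro ⟨y, rfl⟩
      exact ⟨φ k y, rfl⟩
    · rintro ⟨c, rfl⟩
      refine ⟨c • ψ k, ?_⟩
      simp [proj, h.biorthogonal]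
  rw [this]
  exact finrank_span_singleton (h.ne_zero k)

/-- The part of the inverse off the `k`-th eigenvector. -/
noncomputable def reducedInverse (K : E →L[ℂ] E) (ψ : ℕ → E) (φ : ℕ → E →L[ℂ] ℂ) (lam : ℕ → ℂ) (k : ℕ) :
    E →L[ℂ] E := K - (lam k)⁻¹ • proj ψ φ k

/-- Testing a kernel vector `f` against the dual functionals gives `(λ_j - ζ) φ_j f = 0` for `j ≠
k`, while `φ_k` annihilates the range of the reduced inverse. All `φ_j f` therefore vanish and
totality applies. The point `ζ = λ_k` is allowed, which is the purpose of removing the `k`-th mode.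
-/
theorem isUnit_reduced [CompleteSpace E] (h : BiorthogonalSystem A K ψ φ lam) (k : ℕ) {ζ : ℂ}
    (hζ : ∀ j, j ≠ k → ζ ≠ lam j) : IsUnit (1 - ζ • reducedInverse K ψ φ lam k) := by
  refine isUnit_one_sub_smul (h.compact.sub ((isCompactOperator_smulRight (φ k) (ψ k)).smul _)) ζ fun f hf => ?_
  refine h.total f fun j => ?_
  have h1 := congrArg (φ j) hf
  simp only [reducedInverse, sub_apply, smul_apply, proj,
    ContinuousLinearMap.smulRight_apply, map_smul, map_sub, h.dual_inverse, h.biorthogonal,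
    smul_eq_mul] at h1
  by_cases hj : j = k
  · subst hj
    simpa using h1
  · simp only [hj, if_false, mul_zero, sub_zero] at h1
    have h2 : (lam j - ζ) * φ j f = 0 := by
      have := h.lam_ne_zero j
      field_simp at h1
      linear_combination h1
    rcases mul_eq_zero.1 h2 with h3 | h3
    · exact absurd (sub_eq_zero.1 h3).symm (hζ j hj)
    · exact h3

/-- `K = K' + λ_k⁻¹ P` with `K'P = PK' = 0`, so `1 - ζK` decouples and each part is inverted
separately. The formula isolates the singular part of the resolvent at `λ_k`. -/
theorem resolvent_formula [CompleteSpace E] (h : BiorthogonalSystem A K ψ φ lam) (k : ℕ) {ζ : ℂ}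
    (hζ : ∀ j, ζ ≠ lam j) :
    IsResolventAt A ζ ((ζ - lam k)⁻¹ • proj ψ φ k -
      reducedInverse K ψ φ lam k * Ring.inverse (1 - ζ • reducedInverse K ψ φ lam k)) := by
  have hu := h.isUnit_reduced k (fun j _ => hζ j)
  have hζk : ζ - lam k ≠ 0 := sub_ne_zero.2 (hζ k)
  have hζk' : lam k - ζ ≠ 0 := sub_ne_zero.2 (hζ k).symm
  have hl := h.lam_ne_zero k
  set P := proj ψ φ k with hP
  set K' := reducedInverse K ψ φ lam k with hK'
  have hKK : K = K' + (lam k)⁻¹ • P := by rw [hK', reducedInverse, ← hP, sub_add_cancel]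
  have hPP : P * P = P := by ext x; simp [hP, proj, h.biorthogonal]
  have hKP : K' * P = 0 := by
    ext x; simp [hK', reducedInverse, hP, proj, h.biorthogonal, h.inverse_eigenvector]
  have hPK : P * K' = 0 := by
    ext x; simp [hK', reducedInverse, hP, proj, h.biorthogonal, h.dual_inverse]
  set U := Ring.inverse (1 - ζ • K') with hU
  have hU1 : U * (1 - ζ • K') = 1 := Ring.inverse_mul_cancel _ hu
  have hU2 : (1 - ζ • K') * U = 1 := Ring.mul_inverse_cancel _ hu
  have hUP : U * P = P := by
    calc U * P = U * ((1 - ζ • K') * P) := by rw [sub_mul, smul_mul_assoc, hKP]; simp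
      _ = P := by rw [← mul_assoc, hU1, one_mul]
  have hPU : P * U = P := by
    calc P * U = P * (1 - ζ • K') * U := by rw [mul_sub, mul_smul_comm, hPK]; simp
      _ = P := by rw [mul_assoc, hU2, mul_one]
  have e1 : 1 - ζ • K = (1 - ζ • K') - (ζ / lam k) • P := by
    rw [hKK, smul_add, smul_smul, div_eq_mul_inv]; abel
  -- On the range of `P` the operator `U` is the identity while `1 - ζK` is the scalar `1 - ζ/λ_k`;
  -- the coefficient is what must be added to 1 to reach its reciprocal `λ_k/(λ_k - ζ)`.
  set V := U + (ζ / (lam k - ζ)) • P with hV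
  have hV1 : V * (1 - ζ • K) = 1 := by
    rw [e1, hV, add_mul, mul_sub, hU1, mul_smul_comm, hUP, smul_mul_assoc, mul_sub, mul_smul_comm,
      hPP, mul_sub, mul_smul_comm, hPK, smul_zero, sub_zero, mul_one, smul_sub, smul_smul]
    have : (ζ / (lam k - ζ)) • P - (ζ / (lam k - ζ) * (ζ / lam k)) • P = (ζ / lam k) • P := by
      rw [← sub_smul]; congr 1; field_simp
    rw [this]; abel
  have hV2 : (1 - ζ • K) * V = 1 := by
    rw [e1, hV, mul_add, sub_mul, hU2, smul_mul_assoc, hPU, mul_smul_comm, sub_mul, smul_mul_assoc,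
      hPP, sub_mul, smul_mul_assoc, hKP, smul_zero, sub_zero, one_mul, smul_sub, smul_smul]
    have : (ζ / (lam k - ζ)) • P - (ζ / (lam k - ζ) * (ζ / lam k)) • P = (ζ / lam k) • P := by
      rw [← sub_smul]; congr 1; field_simp
    rw [this]; abel
  convert h.isInverse.isResolventAt hV1 hV2 using 1
  rw [hKK, hV, add_mul, mul_add, mul_add, mul_smul_comm, hKP, smul_mul_assoc, hPU, smul_zero,
    add_zero, mul_smul_comm, smul_mul_assoc, hPP, smul_smul, ← add_smul,
    neg_add, sub_eq_add_neg, add_comm]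
  congr 1
  rw [← neg_smul]
  congr 1
  rw [← neg_sub (lam k) ζ]
  field_simp
  ring

theorem opSpectrum_eq [CompleteSpace E] (h : BiorthogonalSystem A K ψ φ lam) :
    opSpectrum A = Set.range lam := by
  refine Set.Subset.antisymm (fun ζ hζ => ?_) (Set.range_subset_iff.2 h.mem_spectrum)
  by_contra hn
  exact hζ ⟨_, h.resolvent_formula 0 fun j hj => hn ⟨j, hj.symm⟩⟩

/-- The term `K'(1 - ζK')⁻¹` is holomorphic on the whole closed disc, centre included, so Cauchy's
theorem kills it; the other term is a simple pole with residue `P`. -/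
theorem cauchyProjection_eq [CompleteSpace E] (h : BiorthogonalSystem A K ψ φ lam) (k : ℕ) {ε : ℝ}
    (hε : 0 < ε) (hs : ∀ ν ∈ opSpectrum A, ν ≠ lam k → ε < dist ν (lam k)) :
    cauchyProjection A (lam k) ε = proj ψ φ k := by
  have hne : ∀ ζ ∈ Metric.closedBall (lam k) ε, ∀ j, j ≠ k → ζ ≠ lam j := by
    rintro ζ hζ j hj rfl
    exact absurd (hs _ (h.mem_spectrum j) fun e => hj (h.lam_injective e))
      (not_lt.2 (Metric.mem_closedBall.1 hζ))
  have hne' : ∀ ζ ∈ Metric.sphere (lam k) ε, ∀ j, ζ ≠ lam j := by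
    intro ζ hζ j
    by_cases hj : j = k
    · rintro rfl
      subst hj
      simp at hζ
      exact hε.ne hζ
    · exact hne ζ (Metric.sphere_subset_closedBall hζ) j hj
  set K' := reducedInverse K ψ φ lam k
  have hdiff : ∀ ζ ∈ Metric.closedBall (lam k) ε,
      DifferentiableAt ℂ (fun ζ : ℂ => K' * Ring.inverse (1 - ζ • K')) ζ := by
    intro ζ hζ
    obtain ⟨u, hu⟩ := h.isUnit_reduced k (hne ζ hζ)
    have h1 : DifferentiableAt ℂ (Ring.inverse : (E →L[ℂ] E) → _) (1 - ζ • K') := by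
      rw [← hu]; exact (hasFDerivAt_ringInverse (𝕜 := ℂ) u).differentiableAt
    have h2 : DifferentiableAt ℂ (fun ζ : ℂ => 1 - ζ • K') ζ := by fun_prop
    exact (differentiableAt_const _).mul (h1.fun_comp' ζ h2)
  have hcont : ContinuousOn (fun ζ : ℂ => K' * Ring.inverse (1 - ζ • K'))
      (Metric.closedBall (lam k) ε) := fun ζ hζ => (hdiff ζ hζ).continuousAt.continuousWithinAt
  have hzero : (∮ ζ in C(lam k, ε), K' * Ring.inverse (1 - ζ • K')) = 0 :=
    Complex.circleIntegral_eq_zero_of_differentiable_on_off_countable hε.le Set.countable_empty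
      hcont (fun ζ hζ => hdiff ζ (Metric.ball_subset_closedBall hζ.1))
  have hint1 : CircleIntegrable (fun ζ : ℂ => (ζ - lam k)⁻¹ • proj ψ φ k) (lam k) ε := by
    refine ContinuousOn.circleIntegrable hε.le fun ζ hζ => ?_
    have : ζ - lam k ≠ 0 := sub_ne_zero.2 (hne' ζ hζ k)
    have h3 : ContinuousAt (fun ζ : ℂ => (ζ - lam k)⁻¹) ζ :=
      (continuousAt_id.sub continuousAt_const).inv₀ this
    exact (h3.smul continuousAt_const).continuousWithinAt
  have hint2 : CircleIntegrable (fun ζ : ℂ => K' * Ring.inverse (1 - ζ • K')) (lam k) ε :=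
    (hcont.mono Metric.sphere_subset_closedBall).circleIntegrable hε.le
  have hcongr : (∮ ζ in C(lam k, ε), opResolvent A ζ) =
      ∮ ζ in C(lam k, ε), ((ζ - lam k)⁻¹ • proj ψ φ k - K' * Ring.inverse (1 - ζ • K')) :=
    circleIntegral.integral_congr hε.le fun ζ hζ =>
      opResolvent_eq (h.resolvent_formula k (hne' ζ hζ))
  rw [cauchyProjection, hcongr, circleIntegral.integral_sub hint1 hint2, hzero, sub_zero,
    circleIntegral.integral_smul_const, circleIntegral.integral_sub_center_inv _ hε.ne', smul_smul,
    inv_mul_cancel₀ Complex.two_pi_I_ne_zero, one_smul]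

theorem isSpectralProjection_iff [CompleteSpace E] (h : BiorthogonalSystem A K ψ φ lam)
    (k : ℕ) {δ : ℝ} (hδ : 0 < δ) (hsep : ∀ j, j ≠ k → δ < dist (lam j) (lam k)) (Q : E →L[ℂ] E) :
    IsSpectralProjection A (lam k) Q ↔ Q = proj ψ φ k := by
  constructor
  · rintro ⟨ε, hε, hs, rfl⟩
    exact h.cauchyProjection_eq k hε hs
  · rintro rfl
    have hs : ∀ ν ∈ opSpectrum A, ν ≠ lam k → δ < dist ν (lam k) := by
      rw [h.opSpectrum_eq]
      rintro _ ⟨j, rfl⟩ hj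
      exact hsep j fun e => hj (e ▸ rfl)
    exact ⟨δ, hδ, hs, (h.cauchyProjection_eq k hδ hs).symm⟩

end BiorthogonalSystem

end Abstract

section PolyGauss

open Polynomial

/-! ## Polynomials times Gaussians -/

/-- The function `p(x) exp(-x²/2 + c x)`. -/
noncomputable def polyGauss (c : ℂ) (p : ℂ[X]) (x : ℝ) : ℂ :=
  p.eval (x : ℂ) * Complex.exp (-(x : ℂ) ^ 2 / 2 + c * x)

/-- From `|x|^n / n! ≤ exp |x|`. A single type of majorant, `exp(d|x| - x²/2)`, then serves for all
polynomials times Gaussians. -/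
theorem exists_norm_eval_le (p : ℂ[X]) :
    ∃ C : ℝ, 0 ≤ C ∧ ∀ x : ℝ, ‖p.eval (x : ℂ)‖ ≤ C * Real.exp |x| := by
  induction p using Polynomial.induction_on' with
  | add p q hp hq =>
    obtain ⟨C, hC, h⟩ := hp
    obtain ⟨D, hD, h'⟩ := hq
    refine ⟨C + D, by positivity, fun x => ?_⟩
    rw [eval_add, add_mul]
    exact (norm_add_le _ _).trans (add_le_add (h x) (h' x))
  | monomial n a =>
    refine ⟨‖a‖ * n.factorial, by positivity, fun x => ?_⟩
    rw [eval_monomial, norm_mul, norm_pow, Complex.norm_real, mul_assoc]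
    have := Real.pow_div_factorial_le_exp |x| (abs_nonneg x) n
    rw [div_le_iff₀ (by positivity)] at this
    rw [Real.norm_eq_abs, mul_comm (n.factorial : ℝ)]
    gcongr

theorem integrable_exp_abs {b : ℝ} (hb : 0 < b) (d : ℝ) :
    Integrable (fun x : ℝ => Real.exp (d * |x| - b * x ^ 2)) := by
  have key : ∀ d : ℝ, Integrable (fun x : ℝ => Real.exp (d * x - b * x ^ 2)) := by
    intro d
    have h := (integrable_cexp_quadratic (b := (b : ℂ)) (by simpa using hb) (d : ℂ) 0).norm
    refine h.congr (ae_of_all _ fun x => ?_)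
    simp only [Complex.norm_exp]
    congr 1
    have : -(b : ℂ) * (x : ℂ) ^ 2 + d * x + 0 = ((-b * x ^ 2 + d * x : ℝ) : ℂ) := by
      push_cast; ring
    rw [this, Complex.ofReal_re]
    ring
  refine ((key d).add (key (-d))).mono' (by fun_prop) (ae_of_all _ fun x => ?_)
  rw [Real.norm_eq_abs, abs_of_pos (Real.exp_pos _), Pi.add_apply]
  rcases abs_choice x with h | h <;> rw [h]
  · exact le_add_of_nonneg_right (Real.exp_pos _).le
  · rw [show d * -x = -d * x by ring]
    exact le_add_of_nonneg_left (Real.exp_pos _).le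

theorem memLp_exp_abs (d : ℝ) :
    MemLp (fun x : ℝ => Real.exp (d * |x| - x ^ 2 / 2)) 2 volume := by
  rw [memLp_two_iff_integrable_sq_norm (by fun_prop)]
  refine (integrable_exp_abs one_pos (2 * d)).congr (ae_of_all _ fun x => ?_)
  simp only
  rw [Real.norm_eq_abs, abs_of_pos (Real.exp_pos _), ← Real.exp_nat_mul]
  congr 1
  push_cast; ring

theorem norm_gauss_le (c : ℂ) (x : ℝ) :
    ‖Complex.exp (-(x : ℂ) ^ 2 / 2 + c * x)‖ ≤ Real.exp (‖c‖ * |x| - x ^ 2 / 2) := by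
  rw [Complex.norm_exp, Real.exp_le_exp]
  have h1 : (-(x : ℂ) ^ 2 / 2 + c * x).re = - x ^ 2 / 2 + c.re * x := by
    have : (-(x : ℂ) ^ 2 / 2 : ℂ) = ((-x ^ 2 / 2 : ℝ) : ℂ) := by push_cast; ring
    rw [Complex.add_re, this, Complex.ofReal_re, Complex.re_mul_ofReal]
  have h2 : c.re * x ≤ ‖c‖ * |x| := (le_abs_self _).trans (by
    rw [abs_mul]; gcongr; exact Complex.abs_re_le_norm c)
  rw [h1]
  linarith

theorem exists_norm_polyGauss_le (c : ℂ) (p : ℂ[X]) : ∃ C : ℝ, 0 ≤ C ∧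
    ∀ x : ℝ, ‖polyGauss c p x‖ ≤ C * Real.exp ((1 + ‖c‖) * |x| - x ^ 2 / 2) := by
  obtain ⟨C, hC, h⟩ := exists_norm_eval_le p
  refine ⟨C, hC, fun x => ?_⟩
  rw [polyGauss, norm_mul]
  calc _ ≤ (C * Real.exp |x|) * Real.exp (‖c‖ * |x| - x ^ 2 / 2) :=
        mul_le_mul (h x) (norm_gauss_le c x) (norm_nonneg _) (by positivity)
    _ = _ := by rw [mul_assoc, ← Real.exp_add]; ring_nf

theorem hasDerivAt_polyGauss (c : ℂ) (p : ℂ[X]) (x : ℝ) :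
    HasDerivAt (polyGauss c p) (polyGauss c (derivative p + (C c - X) * p) x) x := by
  have h1 : HasDerivAt (fun z : ℂ => p.eval z * Complex.exp (-z ^ 2 / 2 + c * z))
      ((derivative p).eval (x : ℂ) * Complex.exp (-(x : ℂ) ^ 2 / 2 + c * x) +
        p.eval (x : ℂ) * (Complex.exp (-(x : ℂ) ^ 2 / 2 + c * x) * (-x + c))) x := by
    refine (p.hasDerivAt (x : ℂ)).mul ?_
    refine HasDerivAt.cexp ?_
    have h2 := (((hasDerivAt_id (x : ℂ)).pow 2).neg.div_const 2).add
      ((hasDerivAt_id (x : ℂ)).const_mul c)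
    refine h2.congr_deriv ?_
    simp
    ring
  refine h1.comp_ofReal.congr_deriv ?_
  simp only [polyGauss, eval_add, eval_mul, eval_sub, eval_C, eval_X]
  ring

/-- The class is closed under differentiation with `c` fixed, so the induction runs over all `p` at
once. -/
theorem contDiff_polyGauss (c : ℂ) (p : ℂ[X]) : ContDiff ℝ ∞ (polyGauss c p) := by
  rw [contDiff_infty]
  intro n
  induction n generalizing p with
  | zero =>
    rw [Nat.cast_zero, contDiff_zero]
    exact continuous_iff_continuousAt.2 fun x => (hasDerivAt_polyGauss c p x).continuousAt
  | succ n ih =>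
    rw [Nat.cast_succ, contDiff_succ_iff_deriv]
    refine ⟨fun x => (hasDerivAt_polyGauss c p x).differentiableAt, by simp, ?_⟩
    rw [funext fun x => (hasDerivAt_polyGauss c p x).deriv]
    exact ih _

theorem continuous_polyGauss (c : ℂ) (p : ℂ[X]) : Continuous (polyGauss c p) :=
  (contDiff_polyGauss c p).continuous

theorem memLp_polyGauss (c : ℂ) (p : ℂ[X]) : MemLp (polyGauss c p) 2 volume := by
  obtain ⟨C, hC, h⟩ := exists_norm_polyGauss_le c p
  refine ((memLp_exp_abs (1 + ‖c‖)).const_mul C).of_le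
    (continuous_polyGauss c p).aestronglyMeasurable (ae_of_all _ fun x => (h x).trans ?_)
  exact le_abs_self _

/-- The element `p(x) exp(-x²/2 + c x)` of `L²(ℝ)`, linear in `p`. -/
noncomputable def pg (c : ℂ) : ℂ[X] →ₗ[ℂ] L2R where
  toFun p := (memLp_polyGauss c p).toLp _
  map_add' p q := by
    rw [← MemLp.toLp_add]
    exact MemLp.toLp_congr _ _ (ae_of_all _ fun x => by simp [polyGauss, add_mul])
  map_smul' a p := by
    rw [RingHom.id_apply, ← MemLp.toLp_const_smul]
    exact MemLp.toLp_congr _ _ (ae_of_all _ fun x => by simp [polyGauss, mul_assoc])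

theorem coeFn_pg (c : ℂ) (p : ℂ[X]) : pg c p =ᵐ[volume] polyGauss c p :=
  MemLp.coeFn_toLp (memLp_polyGauss c p)

theorem conj_polyGauss (c : ℂ) (p : ℂ[X]) (x : ℝ) :
    starRingEnd ℂ (polyGauss c p x) =
      polyGauss (starRingEnd ℂ c) (p.map (starRingEnd ℂ)) x := by
  rw [polyGauss, polyGauss, map_mul, ← Complex.exp_conj, eval_map]
  congr 1
  · rw [Polynomial.eval, hom_eval₂, Complex.conj_ofReal]; rfl
  · simp [Complex.conj_ofNat]

theorem inner_pg_left (c : ℂ) (p : ℂ[X]) (f : L2R) :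
    inner ℂ (pg c p) f =
      ∫ x, polyGauss (starRingEnd ℂ c) (p.map (starRingEnd ℂ)) x * f x := by
  rw [L2.inner_def]
  refine integral_congr_ae ?_
  filter_upwards [coeFn_pg c p] with x hx
  rw [hx, RCLike.inner_apply', conj_polyGauss]

/-! ## Integration by parts against non-compactly supported functions -/

/-- Weak derivatives are tested on real functions only, so a complex test function is split into
real and imaginary parts. -/
theorem integral_deriv_mul_eq_of_hasCompactSupport {f g : L2R} (h : HasWeakDeriv f g) {u : ℝ → ℂ}
    (hu : ContDiff ℝ ∞ u) (hc : HasCompactSupport u) :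
    ∫ x, deriv u x * f x = - ∫ x, u x * g x := by
  have hd : ∀ x, HasDerivAt u (deriv u x) x := fun x =>
    (hu.differentiable (by simp) x).hasDerivAt
  have hre : ∀ x, deriv (fun x => (u x).re) x = (deriv u x).re := fun x =>
    ((Complex.reCLM.hasFDerivAt.comp_hasDerivAt x (hd x))).deriv
  have him : ∀ x, deriv (fun x => (u x).im) x = (deriv u x).im := fun x =>
    ((Complex.imCLM.hasFDerivAt.comp_hasDerivAt x (hd x))).deriv
  have sre : ContDiff ℝ ∞ (fun x => (u x).re) := Complex.reCLM.contDiff.comp hu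
  have sim : ContDiff ℝ ∞ (fun x => (u x).im) := Complex.imCLM.contDiff.comp hu
  have cre : HasCompactSupport (fun x => (u x).re) := hc.comp_left (g := Complex.re) rfl
  have cim : HasCompactSupport (fun x => (u x).im) := hc.comp_left (g := Complex.im) rfl
  have h1 := h _ sre cre
  have h2 := h _ sim cim
  have i1 := integrable_deriv_test sre cre f
  have i2 := integrable_deriv_test sim cim f
  have j1 := integrable_test sre.continuous cre g
  have j2 := integrable_test sim.continuous cim g
  simp only [hre, him] at h1 h2 i1 i2
  have split : ∀ (z : ℂ) (w : ℂ), z * w = z.re • w + Complex.I * (z.im • w) := by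
    intro z w
    rw [Complex.real_smul, Complex.real_smul]
    nth_rewrite 1 [← Complex.re_add_im z]
    ring
  rw [integral_congr_ae (ae_of_all _ fun x => split (deriv u x) (f x)),
    integral_congr_ae (ae_of_all _ fun x => split (u x) (g x)),
    integral_add i1 (i2.const_mul _), integral_add j1 (j2.const_mul _),
    integral_const_mul, integral_const_mul, h1, h2]
  ring

theorem integrable_mul_L2R {u : ℝ → ℂ} (hu : MemLp u 2 volume) (f : L2R) :
    Integrable (fun x => u x * f x) := hu.integrable_mul (Lp.memLp f)

/-- Multiply `u` by dilated cut-offs and pass to the limit by dominated convergence; this makes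
Gaussians admissible as test functions. -/
theorem integral_deriv_mul_eq {f g : L2R} (h : HasWeakDeriv f g) {u : ℝ → ℂ}
    (hu : ContDiff ℝ ∞ u) (hu2 : MemLp u 2 volume) (hu2' : MemLp (deriv u) 2 volume) :
    ∫ x, deriv u x * f x = - ∫ x, u x * g x := by
  let b : ContDiffBump (0 : ℝ) := ⟨1, 2, one_pos, one_lt_two⟩
  have hb : ContDiff ℝ ∞ (b : ℝ → ℝ) := b.contDiff
  have hbc : HasCompactSupport (b : ℝ → ℝ) := b.hasCompactSupport
  obtain ⟨M, hM⟩ := (hb.continuous_deriv (by simp)).bounded_above_of_compact_support hbc.deriv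
  let s : ℕ → ℝ := fun n => ((n : ℝ) + 1)⁻¹
  have hs : ∀ n, 0 < s n := fun n => by positivity
  have hs1 : ∀ n, s n ≤ 1 := fun n => inv_le_one_of_one_le₀ (by simp)
  let χ : ℕ → ℝ → ℂ := fun n x => ((b (s n * x) : ℝ) : ℂ)
  have hχ : ∀ n x, HasDerivAt (χ n) ((s n * deriv b (s n * x) : ℝ) : ℂ) x := by
    intro n x
    have h1 : HasDerivAt (b : ℝ → ℝ) (deriv b (s n * x)) (s n * x) :=
      (hb.differentiable (by simp) _).hasDerivAt
    have h2 := (h1.comp x ((hasDerivAt_id x).const_mul (s n))).ofReal_comp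
    refine h2.congr_deriv ?_
    rw [mul_one, mul_comm]
  have hχs : ∀ n, ContDiff ℝ ∞ (χ n) := fun n =>
    Complex.ofRealCLM.contDiff.comp (hb.comp (contDiff_const.mul contDiff_id))
  have hχc : ∀ n, HasCompactSupport (χ n) := by
    intro n
    have h1 : HasCompactSupport (fun x => b (s n * x)) :=
      hbc.comp_homeomorph (Homeomorph.mulLeft₀ (s n) (hs n).ne')
    exact h1.comp_left (g := fun y : ℝ => (y : ℂ)) Complex.ofReal_zero
  have key : ∀ n, ∫ x, (((s n * deriv b (s n * x) : ℝ) : ℂ) * (u x * f x) +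
      χ n x * (deriv u x * f x)) = - ∫ x, χ n x * (u x * g x) := by
    intro n
    have h1 := integral_deriv_mul_eq_of_hasCompactSupport h ((hχs n).mul hu) (hχc n).mul_right
    have hd : ∀ x, deriv (fun x => χ n x * u x) x =
        ((s n * deriv b (s n * x) : ℝ) : ℂ) * u x + χ n x * deriv u x := fun x =>
      ((hχ n x).mul (hu.differentiable (by simp) x).hasDerivAt).deriv
    change ∫ x, deriv (fun x => χ n x * u x) x * f x = - ∫ x, χ n x * u x * g x at h1
    simp only [hd] at h1
    simpa only [add_mul, mul_assoc] using h1
  have hsx : ∀ x, Tendsto (fun n => s n * x) atTop (𝓝 0) := by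
    intro x
    have : Tendsto s atTop (𝓝 0) := tendsto_inv_atTop_zero.comp
      (tendsto_atTop_add_const_right _ _ tendsto_natCast_atTop_atTop)
    simpa using this.mul_const x
  -- The bump is constantly 1 near the origin, so at each fixed `x` the cut-off and its derivative
  -- are eventually equal to their limits.
  have hev : ∀ x, ∀ᶠ n in atTop, χ n x = 1 ∧ deriv b (s n * x) = 0 := by
    intro x
    have h0 : (b : ℝ → ℝ) =ᶠ[𝓝 0] fun _ => 1 := by
      filter_upwards [b.eventuallyEq_one] with y hy using hy
    have h1 : ∀ᶠ y in 𝓝 (0 : ℝ), b y = 1 ∧ deriv b y = 0 := by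
      filter_upwards [h0, h0.deriv] with y h2 h3
      exact ⟨h2, by rw [h3]; simp⟩
    filter_upwards [(hsx x).eventually h1] with n hn
    exact ⟨by simp [χ, hn.1], hn.2⟩
  have iuf := integrable_mul_L2R hu2 f
  have iug := integrable_mul_L2R hu2 g
  have iuf' := integrable_mul_L2R hu2' f
  have hb1 : ∀ n x, ‖χ n x‖ ≤ 1 := by
    intro n x
    simp only [χ, Complex.norm_real, Real.norm_eq_abs]
    rw [abs_of_nonneg b.nonneg]
    exact b.le_one
  have hb2 : ∀ n x, ‖((s n * deriv b (s n * x) : ℝ) : ℂ)‖ ≤ M := by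
    intro n x
    rw [Complex.norm_real, norm_mul, Real.norm_eq_abs, abs_of_pos (hs n)]
    calc _ ≤ 1 * ‖deriv b (s n * x)‖ := by gcongr; exact hs1 n
      _ ≤ M := by rw [one_mul]; exact hM _
  have mχ : ∀ n, AEStronglyMeasurable (χ n) volume := fun n =>
    (hχs n).continuous.aestronglyMeasurable
  have mχ' : ∀ n, AEStronglyMeasurable (fun x => ((s n * deriv b (s n * x) : ℝ) : ℂ)) volume := by
    intro n
    have : Continuous (deriv (b : ℝ → ℝ)) := hb.continuous_deriv (by simp)
    exact Continuous.aestronglyMeasurable (by fun_prop)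
  have L1 : Tendsto (fun n => ∫ x, (((s n * deriv b (s n * x) : ℝ) : ℂ) * (u x * f x) +
      χ n x * (deriv u x * f x))) atTop (𝓝 (∫ x, deriv u x * f x)) := by
    refine tendsto_integral_of_dominated_convergence
      (fun x => M * ‖u x * f x‖ + ‖deriv u x * f x‖) (fun n => ?_) ?_ (fun n => ?_) ?_
    · exact ((mχ' n).mul iuf.1).add ((mχ n).mul iuf'.1)
    · exact (iuf.norm.const_mul M).add iuf'.norm
    · refine ae_of_all _ fun x => (norm_add_le _ _).trans (add_le_add ?_ ?_)
      · rw [norm_mul]; gcongr; exact hb2 n x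
      · rw [norm_mul]
        exact mul_le_of_le_one_left (norm_nonneg _) (hb1 n x)
    · refine ae_of_all _ fun x => tendsto_const_nhds.congr' ?_
      filter_upwards [hev x] with n hn
      rw [hn.1, hn.2]; simp
  have L2 : Tendsto (fun n => - ∫ x, χ n x * (u x * g x)) atTop (𝓝 (- ∫ x, u x * g x)) := by
    refine (tendsto_integral_of_dominated_convergence
      (fun x => ‖u x * g x‖) (fun n => ?_) iug.norm (fun n => ?_) ?_).neg
    · exact (mχ n).mul iug.1
    · refine ae_of_all _ fun x => ?_
      rw [norm_mul]
      exact mul_le_of_le_one_left (norm_nonneg _) (hb1 n x)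
    · refine ae_of_all _ fun x => tendsto_const_nhds.congr' ?_
      filter_upwards [hev x] with n hn
      rw [hn.1, one_mul]
  exact tendsto_nhds_unique (L1.congr key) L2

theorem hasWeakDeriv_pg (c : ℂ) (p : ℂ[X]) :
    HasWeakDeriv (pg c p) (pg c (derivative p + (C c - X) * p)) := by
  intro φ hφ hc
  have hd := fun x => (hφ.differentiable (by simp) x).hasDerivAt
  rw [integral_congr_ae (g := fun x => deriv φ x • polyGauss c p x) (by
      filter_upwards [coeFn_pg c p] with x hx; rw [hx]),
    integral_congr_ae (f := fun x => φ x • pg c _ x)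
      (g := fun x => φ x • polyGauss c (derivative p + (C c - X) * p) x) (by
      filter_upwards [coeFn_pg c (derivative p + (C c - X) * p)] with x hx; rw [hx])]
  have hφ' : Continuous (deriv φ) := hφ.continuous_deriv (by simp)
  have e := integral_mul_deriv_eq_deriv_mul_of_integrable (A := ℂ)
    (u := fun x => (φ x : ℂ)) (u' := fun x => ((deriv φ x : ℝ) : ℂ)) (v := polyGauss c p)
    (v' := polyGauss c (derivative p + (C c - X) * p))
    (fun x _ => (hd x).ofReal_comp) (fun x _ => hasDerivAt_polyGauss c p x) ?_ ?_ ?_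
  · simp only [Complex.real_smul]
    rw [e, neg_neg]
  all_goals
    refine Continuous.integrable_of_hasCompactSupport ?_ ?_
  · have := continuous_polyGauss c (derivative p + (C c - X) * p)
    have := hφ.continuous
    simp only [Pi.mul_def]; fun_prop
  · exact (hc.comp_left (g := fun y : ℝ => (y : ℂ)) Complex.ofReal_zero).mul_right
  · have := continuous_polyGauss c p
    simp only [Pi.mul_def]; fun_prop
  · exact (hc.deriv.comp_left (g := fun y : ℝ => (y : ℂ)) Complex.ofReal_zero).mul_right
  · have := continuous_polyGauss c p
    have := hφ.continuous
    simp only [Pi.mul_def]; fun_prop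
  · exact (hc.comp_left (g := fun y : ℝ => (y : ℂ)) Complex.ofReal_zero).mul_right

theorem inner_pg_weakDeriv {f g : L2R} (h : HasWeakDeriv f g) (c : ℂ) (p : ℂ[X]) :
    inner ℂ (pg c p) g = - inner ℂ (pg c (derivative p + (C c - X) * p)) f := by
  rw [inner_pg_left, inner_pg_left]
  have hd : deriv (polyGauss (starRingEnd ℂ c) (p.map (starRingEnd ℂ))) =
      polyGauss (starRingEnd ℂ c) ((derivative p + (C c - X) * p).map (starRingEnd ℂ)) := by
    ext x
    rw [(hasDerivAt_polyGauss _ _ x).deriv]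
    simp [derivative_map]
  rw [← hd, integral_deriv_mul_eq h (contDiff_polyGauss _ _) (memLp_polyGauss _ _)
    (by rw [hd]; exact memLp_polyGauss _ _), neg_neg]

/-! ## Totality -/

/-- All exponential moments are finite; this is the domination needed to integrate the power series
of `exp(itx)` termwise. -/
theorem integrable_exp_mul_pg (c : ℂ) (f : L2R) (t : ℝ) :
    Integrable (fun x => Real.exp (t * |x|) * ‖polyGauss c 1 x * f x‖) := by
  have h1 : MemLp (fun x : ℝ => Real.exp (t * |x|) * ‖polyGauss c 1 x‖) 2 volume := by
    refine (memLp_exp_abs (t + ‖c‖)).of_le ?_ (ae_of_all _ fun x => ?_)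
    · have := continuous_polyGauss c 1
      exact Continuous.aestronglyMeasurable (by fun_prop)
    · rw [Real.norm_eq_abs, Real.norm_eq_abs, abs_of_pos (Real.exp_pos _),
        abs_of_nonneg (by positivity), show (t + ‖c‖) * |x| - x ^ 2 / 2 =
          t * |x| + (‖c‖ * |x| - x ^ 2 / 2) by ring, Real.exp_add]
      gcongr
      simpa [polyGauss] using norm_gauss_le c x
  refine (h1.integrable_mul (Lp.memLp f).norm).congr (ae_of_all _ fun x => ?_)
  simp [mul_assoc]

/-- Every test function is the Fourier transform of a Schwartz function `R`, and `∫ û R = ∫ u R̂`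
transfers the vanishing of `û` to the pairing of `u` with the test function. -/
theorem eq_zero_of_fourier_eq_zero {u : ℝ → ℂ} (hu : Integrable u)
    (h : ∀ t : ℝ, ∫ x : ℝ, Complex.exp (t * x * Complex.I) * u x = 0) : u =ᵐ[volume] 0 := by
  refine ae_eq_zero_of_integral_contDiff_smul_eq_zero hu.locallyIntegrable fun φ hφ hc => ?_
  have hs : ContDiff ℝ ∞ (fun x => (φ x : ℂ)) := Complex.ofRealCLM.contDiff.comp hφ
  let S : SchwartzMap ℝ ℂ := (hc.comp_left (g := fun y : ℝ => (y : ℂ)) Complex.ofReal_zero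
    : HasCompactSupport (fun x => (φ x : ℂ))).toSchwartzMap hs
  let R : SchwartzMap ℝ ℂ := FourierTransform.fourierInv S
  have hR : FourierTransform.fourier (R : ℝ → ℂ) = fun x => (φ x : ℂ) := by
    rw [← SchwartzMap.fourier_coe, FourierTransform.fourier_fourierInv_eq]; rfl
  have h0 : FourierTransform.fourier u = 0 := by
    ext w
    rw [Real.fourier_real_eq_integral_exp_smul, Pi.zero_apply, ← h (-2 * π * w)]
    refine integral_congr_ae (ae_of_all _ fun x => ?_)
    simp only [smul_eq_mul]
    congr 2
    push_cast; ring
  have e := VectorFourier.integral_fourierIntegral_smul_eq_flip (μ := volume) (ν := volume)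
    (L := innerₗ ℝ) Real.continuous_fourierChar continuous_inner hu (R.integrable)
  rw [show (innerₗ ℝ : ℝ →ₗ[ℝ] ℝ →ₗ[ℝ] ℝ).flip = innerₗ ℝ from flip_innerₗ ℝ] at e
  change ∫ ξ, (FourierTransform.fourier u) ξ • R ξ =
    ∫ x, u x • (FourierTransform.fourier (R : ℝ → ℂ)) x at e
  rw [h0, hR] at e
  simp only [Pi.zero_apply, zero_smul, integral_zero] at e
  rw [e]
  refine integral_congr_ae (ae_of_all _ fun x => ?_)
  simp [mul_comm]

/-- Orthogonality to all `p` says that the moments of `f` times a Gaussian vanish. Summing the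
exponential series makes its Fourier transform vanish, and the Gaussian factor has no zeros. -/
theorem eq_zero_of_inner_pg_eq_zero (c : ℂ) (f : L2R) (h : ∀ p, inner ℂ (pg c p) f = 0) :
    f = 0 := by
  set d := starRingEnd ℂ c with hd
  set u : ℝ → ℂ := fun x => polyGauss d 1 x * f x with hu
  have hui : Integrable u := integrable_mul_L2R (memLp_polyGauss _ _) f
  have hmom : ∀ n : ℕ, ∫ x : ℝ, (x : ℂ) ^ n * u x = 0 := by
    intro n
    rw [← h (X ^ n), inner_pg_left]
    refine integral_congr_ae (ae_of_all _ fun x => ?_)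
    simp [hu, hd, polyGauss, mul_assoc]
  have hzero : u =ᵐ[volume] 0 := by
    refine eq_zero_of_fourier_eq_zero hui fun t => ?_
    have hs := hasSum_integral_of_dominated_convergence (μ := volume)
      (F := fun (n : ℕ) (x : ℝ) => ((n.factorial : ℂ)⁻¹ * (t * Complex.I) ^ n) * ((x : ℂ) ^ n * u x))
      (f := fun x : ℝ => Complex.exp (t * x * Complex.I) * u x)
      (fun n x => (|t| * |x|) ^ n / n.factorial * ‖u x‖) (fun n => ?_) (fun n => ?_) ?_ ?_ ?_
    · simp only [integral_const_mul, hmom, mul_zero] at hs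
      exact hs.unique hasSum_zero
    · exact ((Complex.continuous_ofReal.pow n).aestronglyMeasurable.mul hui.1).const_mul _
    · refine ae_of_all _ fun x => le_of_eq ?_
      simp only [norm_mul, norm_pow, norm_inv, Complex.norm_real, Complex.norm_I,
        Complex.norm_natCast, Real.norm_eq_abs, mul_pow]
      ring
    · exact ae_of_all _ fun x => (Real.summable_pow_div_factorial _).mul_right _
    · refine (integrable_exp_mul_pg d f |t|).congr (ae_of_all _ fun x => ?_)
      simp only
      rw [tsum_mul_right, Real.exp_eq_exp_ℝ, NormedSpace.exp_eq_tsum_div]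
    · refine ae_of_all _ fun x => ?_
      have h1 := (NormedSpace.expSeries_div_hasSum_exp ((t * x * Complex.I : ℂ))).mul_right (u x)
      rw [← Complex.exp_eq_exp_ℂ] at h1
      refine h1.congr_fun ?_ 
      intro n
      ring
  refine Lp.ext ?_
  filter_upwards [hzero, Lp.coeFn_zero ℂ 2 (volume : Measure ℝ)] with x hx h0
  rw [h0]
  simp only [hu, polyGauss, eval_one, one_mul, Pi.zero_apply, mul_eq_zero, Complex.exp_ne_zero,
    false_or] at hx
  exact hx

/-! ## The graph of the operators -/

/-- `f ∈ Dom A` and `A f = u`. -/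
def Maps {E : Type*} [NormedAddCommGroup E] [NormedSpace ℂ E] (A : E →ₗ.[ℂ] E) (f u : E) : Prop :=
  ∃ h : f ∈ A.domain, A ⟨f, h⟩ = u

section Maps

variable {E : Type*} [NormedAddCommGroup E] [NormedSpace ℂ E]

theorem maps_opComp {S R : E →ₗ.[ℂ] E} {f u : E} :
    Maps (opComp S R) f u ↔ ∃ g, Maps R f g ∧ Maps S g u := by
  constructor
  · rintro ⟨⟨h1, h2⟩, rfl⟩
    exact ⟨_, ⟨h1, rfl⟩, ⟨h2, rfl⟩⟩
  · rintro ⟨g, ⟨h1, rfl⟩, ⟨h2, rfl⟩⟩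
    exact ⟨⟨h1, h2⟩, rfl⟩

theorem maps_add {S R : E →ₗ.[ℂ] E} {f u : E} :
    Maps (S + R) f u ↔ ∃ s r, Maps S f s ∧ Maps R f r ∧ u = s + r := by
  constructor
  · rintro ⟨⟨h1, h2⟩, rfl⟩
    exact ⟨_, _, ⟨h1, rfl⟩, ⟨h2, rfl⟩, rfl⟩
  · rintro ⟨_, _, ⟨h1, rfl⟩, ⟨h2, rfl⟩, rfl⟩
    exact ⟨⟨h1, h2⟩, rfl⟩

theorem maps_smul {S : E →ₗ.[ℂ] E} {c : ℂ} {f u : E} :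
    Maps (c • S) f u ↔ ∃ s, Maps S f s ∧ u = c • s := by
  constructor
  · rintro ⟨h1, rfl⟩
    exact ⟨_, ⟨h1, rfl⟩, rfl⟩
  · rintro ⟨_, ⟨h1, rfl⟩, rfl⟩
    exact ⟨h1, rfl⟩

end Maps

theorem maps_weakDeriv {f g : L2R} : Maps weakDeriv f g ↔ HasWeakDeriv f g := by
  constructor
  · rintro ⟨h, rfl⟩
    exact h.choose_spec
  · intro h
    have h' : f ∈ weakDeriv.domain := ⟨g, h⟩
    exact ⟨h', (Exists.choose_spec h').unique h⟩

theorem maps_mulOp {m : ℝ → ℂ} {f g : L2R} :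
    Maps (mulOp m) f g ↔ g =ᵐ[volume] fun x => m x * f x := by
  constructor
  · rintro ⟨h, rfl⟩
    exact MemLp.coeFn_toLp (show MemLp (fun x => m x * f x) 2 volume from h)
  · intro h
    have h' : MemLp (fun x => m x * f x) 2 volume := (memLp_congr_ae h).1 (Lp.memLp g)
    exact ⟨h', Lp.ext ((MemLp.coeFn_toLp h').trans h.symm)⟩

theorem maps_opD {f g : L2R} : Maps opD f g ↔ HasWeakDeriv f (Complex.I • g) := by
  rw [opD, maps_smul]
  simp only [maps_weakDeriv]
  constructor
  · rintro ⟨s, hs, rfl⟩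
    rwa [smul_smul, mul_one_div_cancel Complex.I_ne_zero, one_smul]
  · intro h
    exact ⟨_, h, by rw [smul_smul, one_div_mul_cancel Complex.I_ne_zero, one_smul]⟩

theorem maps_opD_opD {f u : L2R} : Maps (opComp opD opD) f u ↔
    ∃ f₁, HasWeakDeriv f f₁ ∧ HasWeakDeriv f₁ (-u) := by
  rw [maps_opComp]
  simp only [maps_opD]
  constructor
  · rintro ⟨g, h1, h2⟩
    refine ⟨_, h1, ?_⟩
    have := h2.smul Complex.I
    rwa [smul_smul, Complex.I_mul_I, neg_one_smul] at this
  · rintro ⟨f₁, h1, h2⟩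
    refine ⟨-Complex.I • f₁, ?_, ?_⟩
    · rwa [smul_smul, mul_neg, Complex.I_mul_I, neg_neg, one_smul]
    · have := h2.smul (-Complex.I)
      rwa [neg_smul Complex.I (-u), smul_neg, neg_neg] at this

/-- `u = -f'' + x² f + 2iα x f + 2β f'`, with all terms in `L²(ℝ)`; the four functions are
`f₁ = f'`, `f₂ = f''`, `v = x f` and `w = x² f`. -/
structure OscTerms (α β : ℝ) (f u f₁ f₂ v w : L2R) : Prop where
  deriv_one : HasWeakDeriv f f₁
  deriv_two : HasWeakDeriv f₁ f₂
  mul_one : v =ᵐ[volume] fun x : ℝ => (x : ℂ) * f x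
  mul_two : w =ᵐ[volume] fun x : ℝ => (x : ℂ) ^ 2 * f x
  eq : u = -f₂ + w + (2 * Complex.I * (α : ℂ)) • v + (2 * (β : ℂ)) • f₁

/-- `f` lies in the domain of `T` and `u = T f + 2iα x f + 2β f'`. -/
def OscRel (α β : ℝ) (f u : L2R) : Prop := ∃ f₁ f₂ v w, OscTerms α β f u f₁ f₂ v w

theorem maps_oscT {f u : L2R} : Maps oscT f u ↔ ∃ f₁ f₂ w : L2R, HasWeakDeriv f f₁ ∧
    HasWeakDeriv f₁ f₂ ∧ (w =ᵐ[volume] fun x : ℝ => (x : ℂ) ^ 2 * f x) ∧ u = -f₂ + w := by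
  rw [oscT, maps_add]
  simp only [maps_opD_opD, maps_mulOp]
  constructor
  · rintro ⟨s, r, ⟨f₁, h1, h2⟩, h3, rfl⟩
    exact ⟨f₁, -s, r, h1, h2, h3, by rw [neg_neg]⟩
  · rintro ⟨f₁, f₂, w, h1, h2, h3, rfl⟩
    exact ⟨-f₂, w, ⟨f₁, h1, by rwa [neg_neg]⟩, h3, rfl⟩

theorem exists_mul_of_mem_oscT {f : L2R} (hf : f ∈ oscT.domain) :
    ∃ v : L2R, v =ᵐ[volume] fun x => (x : ℂ) * f x := by
  -- `Dom L = Dom T` at `a = 1` already contains the interpolation bound: multiplication by `2ix`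
  -- and by `x` have the same domain.
  rw [← oscL_domain 1] at hf
  have h : MemLp (fun x : ℝ => 2 * Complex.I * ((1 : ℝ) : ℂ) * (x : ℂ) * f x) 2 volume := hf.2
  have h' : MemLp (fun x : ℝ => (x : ℂ) * f x) 2 volume := by
    refine (h.const_mul ((2 * Complex.I)⁻¹)).ae_eq (ae_of_all _ fun x => ?_)
    have := Complex.I_ne_zero
    simp only [Complex.ofReal_one]
    field_simp
  exact ⟨h'.toLp _, MemLp.coeFn_toLp h'⟩

theorem maps_oscL {a : ℝ} {f u : L2R} : Maps (oscL a) f u ↔ OscRel a 0 f u := by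
  have hmul : ∀ {v : L2R}, (v =ᵐ[volume] fun x => (x : ℂ) * f x) →
      Maps (mulOp fun x => 2 * Complex.I * (a : ℂ) * (x : ℂ)) f ((2 * Complex.I * (a : ℂ)) • v) := by
    intro v hv
    rw [maps_mulOp]
    filter_upwards [hv, Lp.coeFn_smul (2 * Complex.I * (a : ℂ)) v] with x h1 h2
    rw [h2, Pi.smul_apply, h1, smul_eq_mul, mul_assoc _ (x : ℂ)]
  rw [oscL, maps_add]
  constructor
  · rintro ⟨s, r, hs, hr, rfl⟩
    obtain ⟨v, hv⟩ := exists_mul_of_mem_oscT hs.1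
    obtain ⟨f₁, f₂, w, h1, h2, h3, rfl⟩ := maps_oscT.1 hs
    refine ⟨f₁, f₂, v, w, h1, h2, hv, h3, ?_⟩
    obtain ⟨_, e1⟩ := hmul hv
    obtain ⟨_, e2⟩ := hr
    rw [← e1, ← e2]
    simp
  · rintro ⟨f₁, f₂, v, w, h⟩
    exact ⟨-f₂ + w, _, maps_oscT.2 ⟨f₁, f₂, w, h.deriv_one, h.deriv_two, h.mul_two, rfl⟩,
      hmul h.mul_one, by rw [h.eq]; simp⟩

theorem maps_oscLTilde {a : ℝ} {f u : L2R} : Maps (oscLTilde a) f u ↔ OscRel 0 a f u := by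
  have hI : ∀ g : L2R, (2 * Complex.I * (a : ℂ)) • g = (2 * (a : ℂ)) • (Complex.I • g) := by
    intro g; rw [smul_smul]; ring_nf
  rw [oscLTilde, maps_add]
  simp only [maps_smul, maps_opD]
  constructor
  · rintro ⟨s, r, hs, ⟨g, hg, rfl⟩, rfl⟩
    obtain ⟨v, hv⟩ := exists_mul_of_mem_oscT hs.1
    obtain ⟨f₁, f₂, w, h1, h2, h3, rfl⟩ := maps_oscT.1 hs
    refine ⟨f₁, f₂, v, w, h1, h2, hv, h3, ?_⟩
    rw [hI, hg.unique h1]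
    simp
  · rintro ⟨f₁, f₂, v, w, h⟩
    refine ⟨-f₂ + w, _, maps_oscT.2 ⟨f₁, f₂, w, h.deriv_one, h.deriv_two, h.mul_two, rfl⟩,
      ⟨-Complex.I • f₁, ?_, rfl⟩, ?_⟩
    · rw [smul_smul, mul_neg, Complex.I_mul_I, neg_neg, one_smul]
      exact h.deriv_one
    · rw [hI, smul_smul Complex.I, mul_neg, Complex.I_mul_I, neg_neg, one_smul, h.eq]
      simp

theorem OscTerms.oscT_eq {α β : ℝ} {f u f₁ f₂ v w : L2R} (h : OscTerms α β f u f₁ f₂ v w) :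
    Maps oscT f (-f₂ + w) :=
  maps_oscT.2 ⟨f₁, f₂, w, h.deriv_one, h.deriv_two, h.mul_two, rfl⟩

theorem maps_oscT_iff_oscRel {f u : L2R} : Maps oscT f u ↔ OscRel 0 0 f u := by
  constructor
  · intro hs
    obtain ⟨v, hv⟩ := exists_mul_of_mem_oscT hs.1
    obtain ⟨f₁, f₂, w, h1, h2, h3, rfl⟩ := maps_oscT.1 hs
    exact ⟨f₁, f₂, v, w, h1, h2, hv, h3, by simp⟩
  · rintro ⟨f₁, f₂, v, w, h⟩
    rw [h.eq]
    simpa using OscTerms.oscT_eq h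

/-! ## Action on polynomials times Gaussians -/

/-- The exponent `c = β - iα` of the eigenfunctions. -/
noncomputable def expo (α β : ℝ) : ℂ := (β : ℂ) - Complex.I * α

/-- The polynomial part of `(d/dx)(p(x) exp(-x²/2 + c x))`. -/
noncomputable def gradPoly (c : ℂ) : ℂ[X] →ₗ[ℂ] ℂ[X] :=
  derivative + LinearMap.mulLeft ℂ (C c - X)

theorem gradPoly_apply (c : ℂ) (p : ℂ[X]) : gradPoly c p = derivative p + (C c - X) * p := rfl

/-- The action of the operator on polynomial parts. -/
noncomputable def oscPoly (α β : ℝ) : ℂ[X] →ₗ[ℂ] ℂ[X] :=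
  -(derivative ∘ₗ derivative) + LinearMap.mulLeft ℂ (2 * (X + C (Complex.I * α))) ∘ₗ derivative +
    LinearMap.mulLeft ℂ (C (1 + (α : ℂ) ^ 2 + (β : ℂ) ^ 2))

theorem oscPoly_apply (α β : ℝ) (p : ℂ[X]) : oscPoly α β p = -derivative (derivative p) +
    2 * (X + C (Complex.I * α)) * derivative p + C (1 + (α : ℂ) ^ 2 + (β : ℂ) ^ 2) * p := rfl

/-- The exponent `c = β - iα` is the one for which, after conjugation by the Gaussian, the terms `x
p` cancel and the zeroth-order coefficient becomes the constant `1 + α² + β²`. -/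
theorem oscPoly_eq (α β : ℝ) (p : ℂ[X]) : oscPoly α β p =
    -gradPoly (expo α β) (gradPoly (expo α β) p) + X * (X * p) +
      (2 * Complex.I * (α : ℂ)) • (X * p) + (2 * (β : ℂ)) • gradPoly (expo α β) p := by
  simp only [oscPoly_apply, gradPoly_apply, expo, derivative_add, derivative_mul, derivative_sub,
    derivative_C, derivative_X, smul_eq_C_mul, C_add, C_sub, C_mul, C_pow, C_1, map_ofNat]
  have hI : (C Complex.I : ℂ[X]) ^ 2 = -1 := by
    rw [← C_pow, Complex.I_sq, C_neg, C_1]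
  linear_combination (C (α : ℂ) ^ 2 * p) * hI

theorem mul_pg (c : ℂ) (p : ℂ[X]) : pg c (X * p) =ᵐ[volume] fun x => (x : ℂ) * pg c p x := by
  filter_upwards [coeFn_pg c p, coeFn_pg c (X * p)] with x h1 h2
  rw [h1, h2]
  simp [polyGauss, mul_assoc]

theorem oscTerms_pg (α β : ℝ) (p : ℂ[X]) :
    OscTerms α β (pg (expo α β) p) (pg (expo α β) (oscPoly α β p))
      (pg (expo α β) (gradPoly (expo α β) p))
      (pg (expo α β) (gradPoly (expo α β) (gradPoly (expo α β) p)))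
      (pg (expo α β) (X * p)) (pg (expo α β) (X * (X * p))) where
  deriv_one := hasWeakDeriv_pg _ _
  deriv_two := hasWeakDeriv_pg _ _
  mul_one := mul_pg _ _
  mul_two := by
    filter_upwards [mul_pg (expo α β) (X * p), mul_pg (expo α β) p] with x h1 h2
    rw [h1, h2, sq, mul_assoc]
  eq := by rw [oscPoly_eq]; simp only [map_add, map_neg, map_smul]

theorem inner_mul_symm {f g v w : L2R} (hv : v =ᵐ[volume] fun x => (x : ℂ) * f x)
    (hw : w =ᵐ[volume] fun x => (x : ℂ) * g x) : inner ℂ v g = inner ℂ f w := by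
  rw [L2.inner_def, L2.inner_def]
  refine integral_congr_ae ?_
  filter_upwards [hv, hw] with x h1 h2
  rw [h1, h2, RCLike.inner_apply', RCLike.inner_apply', map_mul, Complex.conj_ofReal]
  ring

/-- The formal adjoint changes the sign of both parameters. Moving it onto polynomials times
Gaussians is legitimate for every `f` in the domain. -/
theorem inner_oscRel {α β : ℝ} {f u : L2R} (h : OscRel α β f u) (q : ℂ[X]) :
    inner ℂ (pg (expo (-α) (-β)) q) u = inner ℂ (pg (expo (-α) (-β)) (oscPoly (-α) (-β) q)) f := by
  obtain ⟨f₁, f₂, v, w, h⟩ := h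
  set c := expo (-α) (-β) with hc
  have hvw : w =ᵐ[volume] fun x => (x : ℂ) * v x := by
    filter_upwards [h.mul_one, h.mul_two] with x h1 h2
    rw [h1, h2, sq, mul_assoc]
  have e1 : inner ℂ (pg c q) f₁ = - inner ℂ (pg c (gradPoly c q)) f :=
    inner_pg_weakDeriv h.deriv_one c q
  have e2 : inner ℂ (pg c q) f₂ = inner ℂ (pg c (gradPoly c (gradPoly c q))) f := by
    have h1 := inner_pg_weakDeriv h.deriv_two c q
    have h2 := inner_pg_weakDeriv h.deriv_one c (gradPoly c q)
    rw [h1, ← gradPoly_apply, h2, neg_neg, ← gradPoly_apply]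
  have e3 : inner ℂ (pg c q) v = inner ℂ (pg c (X * q)) f :=
    (inner_mul_symm (mul_pg c q) h.mul_one).symm
  have e4 : inner ℂ (pg c q) w = inner ℂ (pg c (X * (X * q))) f := by
    rw [inner_mul_symm (mul_pg c (X * q)) h.mul_one, inner_mul_symm (mul_pg c q) hvw]
  rw [h.eq, oscPoly_eq, ← hc]
  simp only [map_add, map_neg, map_smul, inner_add_left, inner_add_right, inner_neg_left,
    inner_neg_right, inner_smul_left, inner_smul_right, e1, e2, e3, e4, map_mul,
    Complex.conj_ofReal, Complex.conj_I, Complex.ofReal_neg, map_ofNat]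
  ring

/-! ## Shifted Hermite polynomials -/

/-- The Hermite polynomials `H_k(x + z)`. -/
noncomputable def hermiteShift (z : ℂ) : ℕ → ℂ[X]
  | 0 => 1
  | k + 1 => 2 * (X + C z) * hermiteShift z k - derivative (hermiteShift z k)

theorem derivative_hermiteShift_succ (z : ℂ) (k : ℕ) :
    derivative (hermiteShift z (k + 1)) = C (2 * ((k : ℂ) + 1)) * hermiteShift z k := by
  induction k with
  | zero => simp [hermiteShift, ← map_ofNat C]
  | succ k ih =>
    rw [hermiteShift, derivative_sub, ih, derivative_mul, ih]
    have : derivative (C (2 * ((k : ℂ) + 1)) * hermiteShift z k) =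
        C (2 * ((k : ℂ) + 1)) * derivative (hermiteShift z k) := by
      rw [derivative_mul, derivative_C, zero_mul, zero_add]
    rw [this]
    conv_lhs => rw [hermiteShift]
    conv_rhs => rw [hermiteShift]
    simp only [derivative_mul, derivative_add, derivative_X, derivative_C, derivative_ofNat,
      C_mul, C_add, C_1, map_ofNat]
    push_cast
    simp only [C_add, C_1]
    ring

/-- Hermite's equation in the variable `x + iα`: the lowering relation turns `H'` into a multiple of
the previous polynomial, and the defining recursion closes the identity. -/
theorem oscPoly_hermiteShift (α β : ℝ) (k : ℕ) :
    oscPoly α β (hermiteShift (Complex.I * α) k) =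
      (1 + 2 * (k : ℂ) + (α : ℂ) ^ 2 + (β : ℂ) ^ 2) • hermiteShift (Complex.I * α) k := by
  rw [oscPoly_apply]
  cases k with
  | zero => simp [hermiteShift, smul_eq_C_mul]
  | succ k =>
    rw [derivative_hermiteShift_succ, derivative_mul, derivative_C, zero_mul, zero_add,
      hermiteShift, smul_eq_C_mul]
    push_cast
    simp only [C_mul, C_add, C_1, map_ofNat, C_pow]
    ring

/-- The span contains 1 and is stable under multiplication by `X`, since `x H_k = (H_{k+1} + H_k')/2
- z H_k` and `H_k'` is a multiple of `H_{k-1}`. -/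
theorem span_hermiteShift (z : ℂ) : Submodule.span ℂ (Set.range (hermiteShift z)) = ⊤ := by
  set S := Submodule.span ℂ (Set.range (hermiteShift z)) with hS
  have hmem : ∀ k, hermiteShift z k ∈ S := fun k => Submodule.subset_span ⟨k, rfl⟩
  have hder : ∀ k, derivative (hermiteShift z k) ∈ S := by
    intro k
    cases k with
    | zero => simp [hermiteShift]
    | succ k =>
      rw [derivative_hermiteShift_succ, ← smul_eq_C_mul]
      exact S.smul_mem _ (hmem k)
  have hX : ∀ p ∈ S, X * p ∈ S := by
    intro p hp
    induction hp using Submodule.span_induction with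
    | mem x hx =>
      obtain ⟨k, rfl⟩ := hx
      have : X * hermiteShift z k = (2⁻¹ : ℂ) • (hermiteShift z (k + 1) +
          derivative (hermiteShift z k)) - z • hermiteShift z k := by
        rw [hermiteShift, sub_add_cancel, smul_eq_C_mul, smul_eq_C_mul]
        have h2 : (C (2⁻¹ : ℂ) : ℂ[X]) * 2 = 1 := by
          rw [← map_ofNat C, ← C_mul]; norm_num
        linear_combination -((X + C z) * hermiteShift z k) * h2
      rw [this]
      exact S.sub_mem (S.smul_mem _ (S.add_mem (hmem _) (hder k))) (S.smul_mem _ (hmem k))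
    | zero => simp
    | add x y _ _ hx hy => rw [mul_add]; exact S.add_mem hx hy
    | smul a x _ hx => rw [mul_smul_comm]; exact S.smul_mem _ hx
  have hpow : ∀ n : ℕ, (X : ℂ[X]) ^ n ∈ S := by
    intro n
    induction n with
    | zero => simpa [hermiteShift] using hmem 0
    | succ n ih => rw [pow_succ']; exact hX _ ih
  rw [eq_top_iff]
  intro p _
  induction p using Polynomial.induction_on' with
  | add p q hp hq => exact S.add_mem (hp trivial) (hq trivial)
  | monomial n a =>
    rw [← C_mul_X_pow_eq_monomial, ← smul_eq_C_mul]
    exact S.smul_mem _ (hpow n)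

theorem eq_zero_of_inner_hermite_eq_zero (c z : ℂ) {f : L2R}
    (h : ∀ k, inner ℂ (pg c (hermiteShift z k)) f = 0) : f = 0 := by
  refine eq_zero_of_inner_pg_eq_zero c f fun p => ?_
  have hp : p ∈ Submodule.span ℂ (Set.range (hermiteShift z)) := by
    rw [span_hermiteShift]; trivial
  induction hp using Submodule.span_induction with
  | mem x hx => obtain ⟨k, rfl⟩ := hx; exact h k
  | zero => simp
  | add x y _ _ hx hy => rw [map_add, inner_add_left, hx, hy, add_zero]
  | smul a x _ hx => rw [map_smul, inner_smul_left, hx, mul_zero]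

/-! ## A priori estimate and bounded inverse -/

/-- Here `f₁, f₂, v, w, z, z'` stand for `f', f'', xf, x²f, xf', x²f'`, and the hypotheses are
integrations by parts. The perturbations contribute nothing to `Re ⟨f, u⟩ = ‖f'‖² + ‖xf‖²`, and the
uncertainty identity `‖f‖² = -2 Re ⟨xf, f'⟩` then gives `‖f‖ ≤ ‖u‖`. For the second-order terms, `Re
⟨x²f, f''⟩ = ‖f‖² - ‖xf'‖²` bounds `‖x²f‖² + ‖f''‖²` by `‖x²f - f''‖² + 2‖f‖²`. -/
theorem apriori_estimate {E : Type*} [NormedAddCommGroup E] [InnerProductSpace ℂ E] {α β : ℝ}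
    {f u f₁ f₂ v w z z' : E}
    (hu : u = -f₂ + w + (2 * Complex.I * (α : ℂ)) • v + (2 * (β : ℂ)) • f₁)
    (h1 : inner ℂ f f₂ = -inner ℂ f₁ f₁) (h2 : inner ℂ f f₁ = -inner ℂ f₁ f)
    (h3 : inner ℂ f w = inner ℂ v v) (h4 : inner ℂ f v = inner ℂ v f)
    (h5 : inner ℂ v f₁ = -inner ℂ (f + z) f) (h5' : inner ℂ z f = inner ℂ f₁ v)
    (h6 : inner ℂ w f₂ = -inner ℂ ((2 : ℂ) • v + z') f₁) (h6' : inner ℂ z' f₁ = inner ℂ z z) :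
    ‖f‖ ≤ ‖u‖ ∧ ‖f₁‖ ≤ ‖u‖ ∧ ‖v‖ ≤ ‖u‖ ∧ ‖f₂‖ ≤ (3 + 2 * |α| + 2 * |β|) * ‖u‖ ∧
      ‖w‖ ≤ (3 + 2 * |α| + 2 * |β|) * ‖u‖ := by
  have self : ∀ g : E, (inner ℂ g g).re = ‖g‖ ^ 2 := fun g => inner_self_eq_norm_sq (𝕜 := ℂ) g
  have symm : ∀ g h : E, (inner ℂ g h).re = (inner ℂ h g).re := fun g h => inner_re_symm (𝕜 := ℂ) g h
  have i4 : (inner ℂ f v).im = 0 := by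
    have := inner_im_symm (𝕜 := ℂ) f v
    rw [← h4] at this
    simp only [RCLike.im_to_complex] at this
    linarith
  have r2 : (inner ℂ f f₁).re = 0 := by
    have := congrArg Complex.re h2
    rw [Complex.neg_re, symm f₁ f] at this
    linarith
  have a1 : (inner ℂ f u).re = ‖f₁‖ ^ 2 + ‖v‖ ^ 2 := by
    rw [hu, inner_add_right, inner_add_right, inner_add_right, inner_neg_right, h1, h3,
      inner_smul_right, inner_smul_right, neg_neg, ← self, ← self]
    simp [i4, r2]
  have a2 : ‖f‖ ^ 2 = -2 * (inner ℂ v f₁).re := by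
    have := congrArg Complex.re h5
    rw [inner_add_left, h5', Complex.neg_re, Complex.add_re, self, symm f₁ v] at this
    linarith
  have a3 : (inner ℂ w f₂).re = ‖f‖ ^ 2 - ‖z‖ ^ 2 := by
    have := congrArg Complex.re h6
    rw [inner_add_left, h6', Complex.neg_re, Complex.add_re, self, inner_smul_left] at this
    simp only [map_ofNat, Complex.re_ofNat, Complex.mul_re, Complex.im_ofNat, zero_mul,
      sub_zero] at this
    linarith
  have hN := norm_nonneg u
  have b1 : ‖f₁‖ ^ 2 + ‖v‖ ^ 2 ≤ ‖f‖ * ‖u‖ := by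
    rw [← a1]; exact (Complex.re_le_norm _).trans (norm_inner_le_norm f u)
  have b2 : ‖f‖ ^ 2 ≤ 2 * (‖v‖ * ‖f₁‖) := by
    have := (Complex.abs_re_le_norm (inner ℂ v f₁)).trans (norm_inner_le_norm v f₁)
    have h := neg_abs_le (inner ℂ v f₁).re
    linarith
  have c1 : ‖f‖ ≤ ‖u‖ := by
    by_contra hlt
    push Not at hlt
    have : 0 < ‖f‖ := lt_of_le_of_lt hN hlt
    nlinarith [sq_nonneg (‖v‖ - ‖f₁‖), mul_lt_mul_of_pos_left hlt this]
  have b3 : ‖f₁‖ ^ 2 + ‖v‖ ^ 2 ≤ ‖u‖ ^ 2 := b1.trans (by nlinarith)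
  have c2 : ‖f₁‖ ≤ ‖u‖ := by
    refine abs_le_of_sq_le_sq' ?_ hN |>.2
    nlinarith [sq_nonneg ‖v‖]
  have c3 : ‖v‖ ≤ ‖u‖ := by
    refine abs_le_of_sq_le_sq' ?_ hN |>.2
    nlinarith [sq_nonneg ‖f₁‖]
  set s := 1 + 2 * |α| + 2 * |β| with hs
  have hs0 : 0 ≤ s := by positivity
  have d1 : ‖w - f₂‖ ≤ s * ‖u‖ := by
    have e : w - f₂ = u - (2 * Complex.I * (α : ℂ)) • v - (2 * (β : ℂ)) • f₁ := by
      rw [hu]; abel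
    rw [e]
    have n1 : ‖(2 * Complex.I * (α : ℂ)) • v‖ ≤ 2 * |α| * ‖u‖ := by
      rw [norm_smul, norm_mul, norm_mul, Complex.norm_I, Complex.norm_real, Complex.norm_ofNat,
        Real.norm_eq_abs, mul_one]
      gcongr
    have n2 : ‖(2 * (β : ℂ)) • f₁‖ ≤ 2 * |β| * ‖u‖ := by
      rw [norm_smul, norm_mul, Complex.norm_real, Complex.norm_ofNat, Real.norm_eq_abs]
      gcongr
    have := norm_sub_le (u - (2 * Complex.I * (α : ℂ)) • v) ((2 * (β : ℂ)) • f₁)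
    have := norm_sub_le u ((2 * Complex.I * (α : ℂ)) • v)
    rw [hs]
    linarith
  have d2 : ‖w‖ ^ 2 + ‖f₂‖ ^ 2 ≤ ((s + 2) * ‖u‖) ^ 2 := by
    have := norm_sub_sq (𝕜 := ℂ) w f₂
    simp only [RCLike.re_to_complex, a3] at this
    have h7 : ‖w - f₂‖ ^ 2 ≤ (s * ‖u‖) ^ 2 := by gcongr
    have h8 : ‖f‖ ^ 2 ≤ ‖u‖ ^ 2 := by gcongr
    nlinarith [sq_nonneg ‖z‖, mul_nonneg hs0 (sq_nonneg ‖u‖), sq_nonneg ‖u‖]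
  have hs2 : 3 + 2 * |α| + 2 * |β| = s + 2 := by rw [hs]; ring
  rw [hs2]
  refine ⟨c1, c2, c3, ?_, ?_⟩
  · refine abs_le_of_sq_le_sq' ?_ (by positivity) |>.2
    nlinarith [sq_nonneg ‖w‖]
  · refine abs_le_of_sq_le_sq' ?_ (by positivity) |>.2
    nlinarith [sq_nonneg ‖f₂‖]

theorem apriori_estimate_pg (α β : ℝ) (p : ℂ[X]) :
    ‖pg (expo α β) p‖ ≤ ‖pg (expo α β) (oscPoly α β p)‖ ∧
    ‖pg (expo α β) (gradPoly (expo α β) p)‖ ≤ ‖pg (expo α β) (oscPoly α β p)‖ ∧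
    ‖pg (expo α β) (X * p)‖ ≤ ‖pg (expo α β) (oscPoly α β p)‖ ∧
    ‖pg (expo α β) (gradPoly (expo α β) (gradPoly (expo α β) p))‖ ≤
      (3 + 2 * |α| + 2 * |β|) * ‖pg (expo α β) (oscPoly α β p)‖ ∧
    ‖pg (expo α β) (X * (X * p))‖ ≤
      (3 + 2 * |α| + 2 * |β|) * ‖pg (expo α β) (oscPoly α β p)‖ := by
  set c := expo α β with hc
  have ibp : ∀ q r, inner ℂ (pg c q) (pg c (gradPoly c r)) =
      -inner ℂ (pg c (gradPoly c q)) (pg c r) := fun q r =>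
    inner_pg_weakDeriv (hasWeakDeriv_pg c r) c q
  have sym : ∀ q r, inner ℂ (pg c (X * q)) (pg c r) = inner ℂ (pg c q) (pg c (X * r)) :=
    fun q r => inner_mul_symm (mul_pg c q) (mul_pg c r)
  refine apriori_estimate (z := pg c (X * gradPoly c p)) (z' := pg c (X * (X * gradPoly c p)))
    (oscTerms_pg α β p).eq (ibp _ _) (ibp _ _) (sym _ _).symm (sym _ _).symm ?_ (sym _ _) ?_ ?_
  · rw [ibp, ← map_add]
    congr 3
    simp only [gradPoly_apply, derivative_mul, derivative_X]
    ring
  · rw [ibp, ← map_smul, ← map_add]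
    congr 3
    simp only [gradPoly_apply, derivative_mul, derivative_X, smul_eq_C_mul, map_ofNat]
    ring
  · rw [sym]

/-! ### Stability of the differential relation under `L²` limits, and construction of the inverse -/

theorem continuous_integral_smul {φ : ℝ → ℝ} (h : Continuous φ) (hc : HasCompactSupport φ) :
    Continuous fun f : L2R => ∫ x, φ x • f x := by
  have hm : MemLp (fun x => (φ x : ℂ)) 2 volume :=
    (h.memLp_of_hasCompactSupport hc (p := 2) (μ := volume)).ofReal
  have : (fun f : L2R => ∫ x, φ x • f x) = fun f : L2R => inner ℂ (hm.toLp _) f := by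
    ext f
    rw [L2.inner_def]
    refine integral_congr_ae ?_
    filter_upwards [hm.coeFn_toLp] with x hx
    rw [hx, RCLike.inner_apply', Complex.conj_ofReal, Complex.real_smul]
  rw [this]
  fun_prop

theorem HasWeakDeriv.of_tendsto {f g : ℕ → L2R} {f' g' : L2R} (h : ∀ n, HasWeakDeriv (f n) (g n))
    (hf : Tendsto f atTop (𝓝 f')) (hg : Tendsto g atTop (𝓝 g')) : HasWeakDeriv f' g' := by
  intro φ hφ hc
  have h1 := ((continuous_integral_smul (hφ.continuous_deriv (by simp)) hc.deriv).tendsto f').comp hf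
  have h2 := ((continuous_integral_smul hφ.continuous hc).tendsto g').comp hg
  exact tendsto_nhds_unique h1 (h2.neg.congr fun n => (h n φ hφ hc).symm)

/-- Multiplication by `m` may be unbounded on `L²`, so the limit is identified against test
functions `φ`, where `φ m` is again continuous with compact support. -/
theorem ae_eq_mul_of_tendsto {m : ℝ → ℝ} (hm : Continuous m) {f g : ℕ → L2R} {f' g' : L2R}
    (h : ∀ n, g n =ᵐ[volume] fun x => (m x : ℂ) * f n x)
    (hf : Tendsto f atTop (𝓝 f')) (hg : Tendsto g atTop (𝓝 g')) :
    g' =ᵐ[volume] fun x => (m x : ℂ) * f' x := by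
  have hmc : Continuous fun x => (m x : ℂ) := by fun_prop
  have hli : LocallyIntegrable (fun x => (m x : ℂ) * f' x) volume := by
    have := (locallyIntegrable_L2R f').locallyIntegrableOn Set.univ
    rw [← locallyIntegrableOn_univ]
    exact this.continuousOn_mul hmc.continuousOn isOpen_univ.isLocallyClosed
  refine ae_eq_of_integral_contDiff_smul_eq (locallyIntegrable_L2R g') hli fun φ hφ hc => ?_
  have h1 := ((continuous_integral_smul hφ.continuous hc).tendsto g').comp hg
  have h2 := ((continuous_integral_smul (φ := fun x => φ x * m x) (hφ.continuous.mul hm)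
    hc.mul_right).tendsto f').comp hf
  have e : ∀ k : L2R, ∫ x, (φ x * m x) • k x = ∫ x, φ x • ((m x : ℂ) * k x) := fun k =>
    integral_congr_ae (ae_of_all _ fun x => by simp [mul_assoc])
  rw [← e]
  refine tendsto_nhds_unique h1 (h2.congr fun n => ?_)
  simp only [Function.comp, e]
  refine integral_congr_ae ?_
  filter_upwards [h n] with x hx
  rw [hx]

theorem OscTerms.of_tendsto {α β : ℝ} {f u f₁ f₂ v w : ℕ → L2R} {f' u' f₁' f₂' v' w' : L2R}
    (h : ∀ n, OscTerms α β (f n) (u n) (f₁ n) (f₂ n) (v n) (w n))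
    (hf : Tendsto f atTop (𝓝 f')) (hu : Tendsto u atTop (𝓝 u')) (h1 : Tendsto f₁ atTop (𝓝 f₁'))
    (h2 : Tendsto f₂ atTop (𝓝 f₂')) (hv : Tendsto v atTop (𝓝 v')) (hw : Tendsto w atTop (𝓝 w')) :
    OscTerms α β f' u' f₁' f₂' v' w' where
  deriv_one := HasWeakDeriv.of_tendsto (fun n => (h n).deriv_one) hf h1
  deriv_two := HasWeakDeriv.of_tendsto (fun n => (h n).deriv_two) h1 h2
  mul_one := ae_eq_mul_of_tendsto continuous_id (fun n => (h n).mul_one) hf hv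
  mul_two := by
    have := ae_eq_mul_of_tendsto (m := fun x => x ^ 2) (by fun_prop) (f := f) (g := w)
      (fun n => by simpa using (h n).mul_two) hf hw
    simpa using this
  eq := tendsto_nhds_unique hu ((((h2.neg.add hw).add (hv.const_smul _)).add
    (h1.const_smul _)).congr fun n => ((h n).eq).symm)

/-- The eigenvalue with the two real parameters. -/
noncomputable def eigval (α β : ℝ) (k : ℕ) : ℂ := 1 + 2 * (k : ℂ) + (α : ℂ) ^ 2 + (β : ℂ) ^ 2

theorem eigval_eq_ofReal (α β : ℝ) (k : ℕ) :
    eigval α β k = ((1 + 2 * k + α ^ 2 + β ^ 2 : ℝ) : ℂ) := by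
  rw [eigval]; push_cast; rfl

theorem eigval_ne_zero (α β : ℝ) (k : ℕ) : eigval α β k ≠ 0 := by
  rw [eigval_eq_ofReal]
  exact Complex.ofReal_ne_zero.2 (by positivity)

theorem eigval_neg_neg (α β : ℝ) (k : ℕ) : eigval (-α) (-β) k = eigval α β k := by
  simp [eigval]

/-- The eigenvalues are nonzero, so the range contains every eigenfunction, and these are total. -/
theorem dense_range_osc (α β : ℝ) :
    (LinearMap.range (pg (expo α β) ∘ₗ oscPoly α β)).topologicalClosure = ⊤ := by
  rw [Submodule.topologicalClosure_eq_top_iff, Submodule.eq_bot_iff]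
  intro f hf
  refine eq_zero_of_inner_hermite_eq_zero (expo α β) (Complex.I * α) fun k => ?_
  have h1 := (Submodule.mem_orthogonal _ _).1 hf _ ⟨hermiteShift (Complex.I * α) k, rfl⟩
  rw [LinearMap.comp_apply, oscPoly_hermiteShift, map_smul, inner_smul_left, mul_eq_zero] at h1
  refine h1.resolve_left ?_
  exact (_root_.map_ne_zero _).2 (eigval_ne_zero α β k)

theorem exists_tendsto_of_norm_le {V E F : Type*} [AddCommGroup V] [Module ℂ V]
    [NormedAddCommGroup E] [NormedSpace ℂ E] [NormedAddCommGroup F] [NormedSpace ℂ F]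
    [CompleteSpace F] (N : V →ₗ[ℂ] E) (M : V →ₗ[ℂ] F) {D : ℝ} (hD : 0 ≤ D)
    (h : ∀ p, ‖M p‖ ≤ D * ‖N p‖) {p : ℕ → V} {u : E}
    (hu : Tendsto (fun n => N (p n)) atTop (𝓝 u)) :
    ∃ m, Tendsto (fun n => M (p n)) atTop (𝓝 m) ∧ ‖m‖ ≤ D * ‖u‖ := by
  have hc : CauchySeq fun n => M (p n) := by
    rw [Metric.cauchySeq_iff]
    intro ε hε
    -- Dividing by `D + 1` covers the case `D = 0`.
    obtain ⟨k, hk⟩ := Metric.cauchySeq_iff.1 hu.cauchySeq (ε / (D + 1)) (by positivity)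
    refine ⟨k, fun a ha b hb => ?_⟩
    have h1 := hk a ha b hb
    rw [dist_eq_norm, ← map_sub] at h1 ⊢
    rw [lt_div_iff₀ (by positivity)] at h1
    have := h (p a - p b)
    nlinarith [norm_nonneg (N (p a - p b))]
  obtain ⟨m, hm⟩ := cauchySeq_tendsto_of_complete hc
  exact ⟨m, hm, le_of_tendsto_of_tendsto' hm.norm (hu.norm.const_mul D) fun n => h (p n)⟩

/-- Approximate `u` by images of polynomials times Gaussians. The a priori estimate makes each of
the five terms converge separately, and the relation survives the limit. -/
theorem exists_oscTerms (α β : ℝ) (u : L2R) : ∃ f f₁ f₂ v w, OscTerms α β f u f₁ f₂ v w ∧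
    ‖f‖ ≤ ‖u‖ ∧ ‖f₁‖ ≤ ‖u‖ ∧ ‖v‖ ≤ ‖u‖ := by
  set c := expo α β with hc
  set N := pg c ∘ₗ oscPoly α β with hN
  have hu : u ∈ closure (LinearMap.range N : Set L2R) := by
    rw [← Submodule.topologicalClosure_coe, dense_range_osc]; trivial
  obtain ⟨y, hy, hyu⟩ := mem_closure_iff_seq_limit.1 hu
  choose p hp using hy
  have hu' : Tendsto (fun n => N (p n)) atTop (𝓝 u) := by simpa only [hp] using hyu
  have hD : (0 : ℝ) ≤ 3 + 2 * |α| + 2 * |β| := by positivity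
  obtain ⟨f, hf, bf⟩ := exists_tendsto_of_norm_le N (pg c) zero_le_one
    (fun p => by rw [one_mul]; exact (apriori_estimate_pg α β p).1) hu'
  obtain ⟨f₁, hf₁, bf₁⟩ := exists_tendsto_of_norm_le N (pg c ∘ₗ gradPoly c) zero_le_one
    (fun p => by rw [one_mul]; exact (apriori_estimate_pg α β p).2.1) hu'
  obtain ⟨v, hv, bv⟩ := exists_tendsto_of_norm_le N (pg c ∘ₗ LinearMap.mulLeft ℂ X) zero_le_one
    (fun p => by rw [one_mul]; exact (apriori_estimate_pg α β p).2.2.1) hu'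
  obtain ⟨f₂, hf₂, -⟩ := exists_tendsto_of_norm_le N (pg c ∘ₗ gradPoly c ∘ₗ gradPoly c) hD
    (fun p => (apriori_estimate_pg α β p).2.2.2.1) hu'
  obtain ⟨w, hw, -⟩ := exists_tendsto_of_norm_le N
    (pg c ∘ₗ LinearMap.mulLeft ℂ X ∘ₗ LinearMap.mulLeft ℂ X) hD
    (fun p => (apriori_estimate_pg α β p).2.2.2.2) hu'
  rw [one_mul] at bf bf₁ bv
  exact ⟨f, f₁, f₂, v, w, OscTerms.of_tendsto (fun n => oscTerms_pg α β (p n)) hf hu' hf₁ hf₂ hv hw,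
    bf, bf₁, bv⟩

/-- The dual eigenfunctions. -/
noncomputable def dualFun (α β : ℝ) (k : ℕ) : L2R :=
  pg (expo (-α) (-β)) (hermiteShift (Complex.I * ((-α : ℝ) : ℂ)) k)

/-- The eigenfunctions. -/
noncomputable def eigFun (α β : ℝ) (k : ℕ) : L2R :=
  pg (expo α β) (hermiteShift (Complex.I * α) k)

theorem oscRel_eigFun (α β : ℝ) (k : ℕ) :
    OscRel α β (eigFun α β k) (eigval α β k • eigFun α β k) := by
  have := oscTerms_pg α β (hermiteShift (Complex.I * α) k)
  rw [oscPoly_hermiteShift, map_smul] at this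
  exact ⟨_, _, _, _, this⟩

theorem inner_dualFun {α β : ℝ} {f u : L2R} (h : OscRel α β f u) (k : ℕ) :
    inner ℂ (dualFun α β k) u = eigval α β k * inner ℂ (dualFun α β k) f := by
  rw [dualFun, inner_oscRel h, oscPoly_hermiteShift, map_smul, inner_smul_left]
  congr 1
  change starRingEnd ℂ (eigval (-α) (-β) k) = _
  rw [eigval_neg_neg, eigval_eq_ofReal, Complex.conj_ofReal]

theorem eq_zero_of_inner_dualFun {α β : ℝ} {f : L2R} (h : ∀ k, inner ℂ (dualFun α β k) f = 0) :
    f = 0 := eq_zero_of_inner_hermite_eq_zero _ _ h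

/-- Injectivity comes from totality of the dual eigenfunctions and the nonvanishing of the
eigenvalues; it makes the chosen solutions depend linearly on `u`. The bounds on `f'` and `xf` are
kept for the proof that `K` is compact. -/
theorem exists_inverse {α β : ℝ} {A : L2R →ₗ.[ℂ] L2R} (hA : ∀ f u, Maps A f u ↔ OscRel α β f u) :
    ∃ K : L2R →L[ℂ] L2R, IsInverseOf K A ∧ ∀ u, ∃ f₁ f₂ v w, OscTerms α β (K u) u f₁ f₂ v w ∧
      ‖f₁‖ ≤ ‖u‖ ∧ ‖v‖ ≤ ‖u‖ := by
  have hker : ∀ f : A.domain, A f = 0 → f = 0 := by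
    intro f hf
    have h1 : OscRel α β (f : L2R) 0 := (hA _ _).1 ⟨f.2, hf⟩
    refine Subtype.ext (eq_zero_of_inner_dualFun (α := α) (β := β) fun k => ?_)
    have h2 := inner_dualFun h1 k
    rw [inner_zero_right, eq_comm, mul_eq_zero] at h2
    exact h2.resolve_left (eigval_ne_zero α β k)
  have hinj : Function.Injective A.toFun := (injective_iff_map_eq_zero A.toFun).2 hker
  choose S S₁ S₂ Sv Sw hS bS bS₁ bSv using exists_oscTerms α β
  have hm : ∀ u, Maps A (S u) u := fun u => (hA _ _).2 ⟨_, _, _, _, hS u⟩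
  choose hd he using hm
  let K₀ : L2R →ₗ[ℂ] L2R :=
    { toFun := S
      map_add' := fun x y => by
        have : (⟨S (x + y), hd _⟩ : A.domain) = ⟨S x, hd x⟩ + ⟨S y, hd y⟩ := by
          apply hinj
          rw [map_add]
          exact (he _).trans (by rw [← he x, ← he y]; simp [he])
        exact congrArg Subtype.val this
      map_smul' := fun a x => by
        have : (⟨S (a • x), hd _⟩ : A.domain) = a • ⟨S x, hd x⟩ := by
          apply hinj
          rw [map_smul]
          exact (he _).trans (by rw [← he x]; simp [he])
        exact congrArg Subtype.val this }
  refine ⟨K₀.mkContinuous 1 fun u => by rw [one_mul]; exact bS u, ⟨fun u => ⟨hd u, he u⟩, fun f => ?_⟩,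
    fun u => ⟨_, _, _, _, hS u, bS₁ u, bSv u⟩⟩
  have : (⟨S (A f), hd _⟩ : A.domain) = f := hinj (he _)
  exact congrArg Subtype.val this

/-! ## Gaussian integrals of Hermite polynomials -/

theorem mul_polyGauss (c d : ℂ) (p q : ℂ[X]) (x : ℝ) : polyGauss c p x * polyGauss d q x =
    (p * q).eval (x : ℂ) * Complex.exp (-(x : ℂ) ^ 2 + (c + d) * x) := by
  rw [polyGauss, polyGauss, eval_mul, mul_mul_mul_comm, ← Complex.exp_add]
  congr 2
  ring

theorem integrable_gauss (b : ℂ) (p : ℂ[X]) :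
    Integrable fun x : ℝ => p.eval (x : ℂ) * Complex.exp (-(x : ℂ) ^ 2 + b * x) := by
  refine ((memLp_polyGauss b p).integrable_mul (memLp_polyGauss 0 1)).congr
    (ae_of_all _ fun x => ?_)
  rw [Pi.mul_apply, mul_polyGauss, mul_one, add_zero]

/-- The functional `p ↦ ∫ p(x) exp(-x² + b x) dx`. -/
noncomputable def gaussInt (b : ℂ) : ℂ[X] →ₗ[ℂ] ℂ where
  toFun p := ∫ x : ℝ, p.eval (x : ℂ) * Complex.exp (-(x : ℂ) ^ 2 + b * x)
  map_add' p q := by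
    rw [← integral_add (integrable_gauss b p) (integrable_gauss b q)]
    simp only [eval_add, add_mul]
  map_smul' a p := by
    rw [RingHom.id_apply, smul_eq_mul, ← integral_const_mul]
    simp only [eval_smul, smul_eq_mul, mul_assoc]

theorem gaussInt_apply (b : ℂ) (p : ℂ[X]) :
    gaussInt b p = ∫ x : ℝ, p.eval (x : ℂ) * Complex.exp (-(x : ℂ) ^ 2 + b * x) := rfl

theorem gaussInt_derivative (b : ℂ) (p : ℂ[X]) :
    gaussInt b (derivative p) = gaussInt b ((2 * X - C b) * p) := by
  have hd : ∀ x : ℝ, HasDerivAt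
      (fun x : ℝ => p.eval (x : ℂ) * Complex.exp (-(x : ℂ) ^ 2 + b * x))
      ((derivative p - (2 * X - C b) * p).eval (x : ℂ) *
        Complex.exp (-(x : ℂ) ^ 2 + b * x)) x := by
    intro x
    have h2 := (((hasDerivAt_id (x : ℂ)).pow 2).neg).add ((hasDerivAt_id (x : ℂ)).const_mul b)
    have h3 := ((p.hasDerivAt (x : ℂ)).mul h2.cexp).comp_ofReal
    refine h3.congr_deriv ?_
    simp
    ring
  have h0 := integral_eq_zero_of_hasDerivAt_of_integrable hd (integrable_gauss b _)
    (integrable_gauss b p)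
  rw [← gaussInt_apply, map_sub, sub_eq_zero] at h0
  exact h0

theorem gaussInt_one (b : ℂ) : gaussInt b 1 = √π * Complex.exp (b ^ 2 / 4) := by
  have h := integral_cexp_quadratic (b := -1) (by simp) b 0
  rw [gaussInt_apply]
  simp only [eval_one, one_mul, neg_one_mul, add_zero] at h ⊢
  rw [h]
  congr 1
  · rw [neg_neg, div_one, Real.sqrt_eq_rpow, Complex.ofReal_cpow Real.pi_pos.le]
    norm_num
  · congr 1; ring

/-- For the weight `exp(-x² - 2zx)`, a constant times `exp(-(x + z)²)`, the raising operator is the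
transpose of `d/dx`. The argument is integration by parts on the real line, so complex `z` needs no
contour shift. -/
theorem gaussInt_hermiteShift_succ_mul (z : ℂ) (j : ℕ) (q : ℂ[X]) :
    gaussInt (-2 * z) (hermiteShift z (j + 1) * q) =
      gaussInt (-2 * z) (hermiteShift z j * derivative q) := by
  have h := gaussInt_derivative (-2 * z) (hermiteShift z j * q)
  have e1 : hermiteShift z (j + 1) * q = (2 * X - C (-2 * z)) * (hermiteShift z j * q) -
      derivative (hermiteShift z j) * q := by
    rw [hermiteShift, C_mul, C_neg, map_ofNat]
    ring
  rw [e1, map_sub, ← h, ← map_sub, derivative_mul]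
  congr 1
  ring

theorem gaussInt_hermiteShift_mul (z : ℂ) (j k : ℕ) :
    gaussInt (-2 * z) (hermiteShift z j * hermiteShift z k) =
      if j = k then 2 ^ k * (k.factorial : ℂ) * (√π * Complex.exp (z ^ 2)) else 0 := by
  induction j generalizing k with
  | zero =>
    cases k with
    | zero =>
      simp only [hermiteShift, mul_one, gaussInt_one]
      rw [if_true, pow_zero, Nat.factorial_zero, Nat.cast_one, one_mul, one_mul]
      ring_nf
    | succ k =>
      rw [mul_comm (hermiteShift z 0), gaussInt_hermiteShift_succ_mul]
      simp [hermiteShift]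
  | succ j ih =>
    rw [gaussInt_hermiteShift_succ_mul]
    cases k with
    | zero => simp [hermiteShift]
    | succ k =>
      rw [derivative_hermiteShift_succ, mul_left_comm, ← smul_eq_C_mul, map_smul, ih]
      simp only [add_left_inj, smul_eq_mul, mul_ite, mul_zero]
      congr 1
      rw [Nat.factorial_succ]
      push_cast
      ring

theorem map_conj_hermiteShift (z : ℂ) (k : ℕ) :
    (hermiteShift z k).map (starRingEnd ℂ) = hermiteShift (starRingEnd ℂ z) k := by
  induction k with
  | zero => simp [hermiteShift]
  | succ k ih =>
    rw [hermiteShift, hermiteShift, Polynomial.map_sub, Polynomial.map_mul, Polynomial.map_mul,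
      Polynomial.map_add, map_X, map_C, ← derivative_map, ih, Polynomial.map_ofNat]

theorem hermiteShift_comp (z w : ℂ) (k : ℕ) :
    (hermiteShift z k).comp (X + C w) = hermiteShift (z + w) k := by
  induction k with
  | zero => simp [hermiteShift]
  | succ k ih =>
    have hd : (derivative (hermiteShift z k)).comp (X + C w) =
        derivative (hermiteShift (z + w) k) := by
      rw [← ih, derivative_comp]; simp
    rw [hermiteShift, hermiteShift, sub_comp, mul_comp, mul_comp, add_comp, X_comp, C_comp, hd, ih,
      ofNat_comp, C_add]
    ring

/-- The raising operator `p ↦ 2(X + z)p - p'`. -/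
noncomputable def raise (z : ℂ) : Module.End ℂ ℂ[X] :=
  LinearMap.mulLeft ℂ (2 * (X + C z)) - derivative

theorem raise_pow_one (z : ℂ) (k : ℕ) : (raise z ^ k) 1 = hermiteShift z k := by
  induction k with
  | zero => rfl
  | succ k ih => rw [pow_succ', Module.End.mul_apply, ih]; rfl

/-- The raising operators differ by the scalar `2z`, which commutes with everything, so the binomial
theorem applies to their powers acting on 1. -/
theorem hermiteShift_eq_sum (z : ℂ) (k : ℕ) : hermiteShift z k =
    ∑ m ∈ Finset.range (k + 1), ((2 * z) ^ (k - m) * (k.choose m : ℂ)) • hermiteShift 0 m := by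
  have h : raise z = raise 0 + (2 * z) • 1 := by
    refine LinearMap.ext fun p => ?_
    simp only [raise, LinearMap.add_apply, LinearMap.sub_apply,
      LinearMap.mulLeft_apply, LinearMap.smul_apply, Module.End.one_apply]
    rw [smul_eq_C_mul]
    simp only [C_mul, C_0, map_ofNat]
    ring_nf
  have hc : Commute (raise 0) ((2 * z) • (1 : Module.End ℂ ℂ[X])) :=
    (Commute.one_right _).smul_right _
  rw [← raise_pow_one, h, hc.add_pow, LinearMap.sum_apply]
  refine Finset.sum_congr rfl fun m _ => ?_
  rw [_root_.smul_pow, one_pow, mul_smul_comm, mul_one, smul_mul_assoc, LinearMap.smul_apply,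
    ← nsmul_eq_mul', LinearMap.smul_apply, raise_pow_one, mul_smul, Nat.cast_smul_eq_nsmul]

theorem gaussInt_two_mul_ofReal (β : ℝ) (p : ℂ[X]) :
    gaussInt (2 * β) p = Complex.exp ((β : ℂ) ^ 2) * gaussInt 0 (p.comp (X + C (β : ℂ))) := by
  rw [gaussInt_apply, gaussInt_apply, ← integral_const_mul,
    ← integral_add_right_eq_self _ β]
  refine integral_congr_ae (ae_of_all _ fun x => ?_)
  simp only [eval_comp, eval_add, eval_X, eval_C, Complex.ofReal_add]
  rw [mul_left_comm, ← Complex.exp_add]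
  congr 2
  ring

/-- The Laguerre polynomial `L_k(-y)`. -/
noncomputable def laguerreNeg (k : ℕ) (y : ℝ) : ℝ :=
  ∑ m ∈ Finset.range (k + 1), (k.choose m : ℝ) * y ^ m / m.factorial

/-- Expanding both factors in unshifted Hermite polynomials, orthogonality leaves only the diagonal
of the double sum. -/
theorem gaussInt_hermiteShift_mul_shift (w w' : ℂ) (k : ℕ) :
    gaussInt 0 (hermiteShift w k * hermiteShift w' k) = √π *
      ∑ m ∈ Finset.range (k + 1), (k.choose m : ℂ) ^ 2 * (4 * (w * w')) ^ (k - m) *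
        (2 ^ m * (m.factorial : ℂ)) := by
  have horth : ∀ m n, gaussInt 0 (hermiteShift 0 m * hermiteShift 0 n) =
      if m = n then 2 ^ n * (n.factorial : ℂ) * √π else 0 := by
    intro m n
    have := gaussInt_hermiteShift_mul 0 m n
    simpa using this
  rw [hermiteShift_eq_sum w, hermiteShift_eq_sum w', Finset.sum_mul_sum, map_sum, Finset.mul_sum]
  refine Finset.sum_congr rfl fun m hm => ?_
  rw [map_sum, Finset.sum_eq_single_of_mem m hm]
  · rw [smul_mul_smul_comm, map_smul, horth, if_pos rfl, smul_eq_mul]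
    have : (4 * (w * w')) ^ (k - m) = (2 * w) ^ (k - m) * (2 * w') ^ (k - m) := by
      rw [← mul_pow]; ring_nf
    rw [this]
    ring
  · intro n _ hn
    rw [smul_mul_smul_comm, map_smul, horth, if_neg hn.symm, smul_zero]

theorem sum_choose_sq_eq (k : ℕ) (s : ℝ) :
    ∑ m ∈ Finset.range (k + 1), (k.choose m : ℝ) ^ 2 * (4 * s) ^ (k - m) *
        (2 ^ m * (m.factorial : ℝ)) = 2 ^ k * k.factorial * laguerreNeg k (2 * s) := by
  rw [laguerreNeg, ← Finset.sum_range_reflect, Finset.mul_sum]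
  refine Finset.sum_congr rfl fun m hm => ?_
  have hm' : m ≤ k := Nat.lt_succ_iff.1 (Finset.mem_range.1 hm)
  rw [show k + 1 - 1 - m = k - m by omega, Nat.choose_symm hm', Nat.sub_sub_self hm']
  have h1 : ((k.choose m : ℝ)) * m.factorial * (k - m).factorial = k.factorial := by
    exact_mod_cast Nat.choose_mul_factorial_mul_factorial hm'
  have h2 : (2 : ℝ) ^ k = 2 ^ m * 2 ^ (k - m) := by rw [← pow_add, Nat.add_sub_cancel' hm']
  have h3 : (4 * s) ^ m = 2 ^ m * (2 * s) ^ m := by rw [← mul_pow]; ring_nf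
  have h4 : (m.factorial : ℝ) ≠ 0 := by positivity
  rw [← h1, h2, h3]
  field_simp

theorem inner_pg_pg (c d : ℂ) (p q : ℂ[X]) : inner ℂ (pg d q) (pg c p) =
    gaussInt (starRingEnd ℂ d + c) (q.map (starRingEnd ℂ) * p) := by
  rw [inner_pg_left, gaussInt_apply]
  refine integral_congr_ae ?_
  filter_upwards [coeFn_pg c p] with x hx
  rw [hx, mul_polyGauss]

theorem conj_expo (α β : ℝ) : starRingEnd ℂ (expo α β) = expo (-α) β := by
  simp [expo]

theorem conj_I_mul (α : ℝ) : starRingEnd ℂ (Complex.I * α) = Complex.I * ((-α : ℝ) : ℂ) := by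
  simp

/-- In the modulus squared the oscillating factor disappears and the weight is `exp(-x² + 2βx)`.
Translating by `β` produces Hermite polynomials with shifts `β ∓ iα`, whose product is `α² + β²`. -/
theorem norm_sq_eigFun (α β : ℝ) (k : ℕ) : ‖eigFun α β k‖ ^ 2 =
    Real.exp (β ^ 2) * (√π * (2 ^ k * k.factorial * laguerreNeg k (2 * (α ^ 2 + β ^ 2)))) := by
  have h : inner ℂ (eigFun α β k) (eigFun α β k) = Complex.exp ((β : ℂ) ^ 2) * (√π *
      ∑ m ∈ Finset.range (k + 1), (k.choose m : ℂ) ^ 2 * (4 * ((α : ℂ) ^ 2 + (β : ℂ) ^ 2)) ^ (k - m) *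
        (2 ^ m * (m.factorial : ℂ))) := by
    rw [eigFun, inner_pg_pg, conj_expo, map_conj_hermiteShift, conj_I_mul]
    have e : expo (-α) β + expo α β = 2 * (β : ℂ) := by simp [expo]; ring
    rw [e, gaussInt_two_mul_ofReal, mul_comp, hermiteShift_comp, hermiteShift_comp,
      gaussInt_hermiteShift_mul_shift]
    have e2 : (Complex.I * ((-α : ℝ) : ℂ) + β) * (Complex.I * α + β) =
        (α : ℂ) ^ 2 + (β : ℂ) ^ 2 := by
      push_cast
      linear_combination -(α : ℂ) ^ 2 * Complex.I_sq
    rw [e2]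
  rw [inner_self_eq_norm_sq_to_K] at h
  rw [← sum_choose_sq_eq]
  apply Complex.ofReal_injective
  push_cast
  exact h

/-- In this pairing the `β` parts of the exponents cancel and the weight is `exp(-x² - 2iαx)`, the
one for which the polynomials shifted by `iα` are orthogonal. -/
theorem inner_dualFun_eigFun (α β : ℝ) (j k : ℕ) : inner ℂ (dualFun α β j) (eigFun α β k) =
    if j = k then ((2 ^ k * k.factorial * (√π * Real.exp (-α ^ 2)) : ℝ) : ℂ) else 0 := by
  rw [dualFun, eigFun, inner_pg_pg, conj_expo, map_conj_hermiteShift, conj_I_mul, neg_neg]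
  have e : expo α (-β) + expo α β = -2 * (Complex.I * α) := by simp [expo]; ring
  rw [e, gaussInt_hermiteShift_mul]
  congr 1
  push_cast
  congr 3
  rw [mul_pow, Complex.I_sq]; ring_nf

theorem dualFun_eq (α β : ℝ) (k : ℕ) : dualFun α β k = eigFun (-α) (-β) k := rfl

/-- The dual eigenfunctionals, normalized to be biorthogonal to the eigenfunctions. -/
noncomputable def dualFunctional (α β : ℝ) (k : ℕ) : L2R →L[ℂ] ℂ :=
  (((2 ^ k * k.factorial * (√π * Real.exp (-α ^ 2)) : ℝ) : ℂ)⁻¹) • innerSL ℂ (dualFun α β k)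

theorem dualFunctional_apply (α β : ℝ) (k : ℕ) (f : L2R) : dualFunctional α β k f =
    (((2 ^ k * k.factorial * (√π * Real.exp (-α ^ 2)) : ℝ) : ℂ)⁻¹) * inner ℂ (dualFun α β k) f :=
  rfl

/-- The dual eigenfunction is the eigenfunction with both parameters negated, and the norm formula
is even in them, so the two norms agree and their product is a single square. -/
theorem norm_proj_eigFun (α β : ℝ) (k : ℕ) :
    ‖BiorthogonalSystem.proj (eigFun α β) (dualFunctional α β) k‖ =
      Real.exp (α ^ 2 + β ^ 2) * laguerreNeg k (2 * (α ^ 2 + β ^ 2)) := by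
  rw [BiorthogonalSystem.proj, ContinuousLinearMap.norm_smulRight_apply, dualFunctional, norm_smul,
    innerSL_apply_norm, norm_inv, Complex.norm_real, Real.norm_eq_abs, abs_of_pos (by positivity)]
  have h1 := norm_sq_eigFun α β k
  have h2 := norm_sq_eigFun (-α) (-β) k
  rw [neg_sq, neg_sq, ← h1, ← dualFun_eq, sq_eq_sq₀ (norm_nonneg _) (norm_nonneg _)] at h2
  rw [h2, mul_assoc, ← sq, h1, Real.exp_add, Real.exp_neg]
  field_simp

theorem biorthogonal_eigFun (α β : ℝ) (j k : ℕ) :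
    dualFunctional α β j (eigFun α β k) = if j = k then 1 else 0 := by
  rw [dualFunctional_apply, inner_dualFun_eigFun]
  split_ifs with h
  · subst h
    exact inv_mul_cancel₀ (Complex.ofReal_ne_zero.2 (by positivity))
  · rw [mul_zero]

/-! ## Compactness of the inverse -/

theorem HilbertBasis.norm_le_of_inner_le {E : Type*} [NormedAddCommGroup E]
    [InnerProductSpace ℂ E] {ι : Type*} (b : HilbertBasis ι ℂ E) {x y : E} {ε : ℝ} (hε : 0 ≤ ε)
    (h : ∀ i, ‖inner ℂ (b i) x‖ ≤ ε * ‖inner ℂ (b i) y‖) : ‖x‖ ≤ ε * ‖y‖ := by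
  have key : ∀ z : E, HasSum (fun i => ‖inner ℂ (b i) z‖ ^ 2) (‖z‖ ^ 2) := by
    intro z
    have h1 := Complex.hasSum_re (b.hasSum_inner_mul_inner z z)
    have h2 : (inner ℂ z z).re = ‖z‖ ^ 2 := inner_self_eq_norm_sq (𝕜 := ℂ) z
    rw [h2] at h1
    refine h1.congr_fun fun i => ?_
    rw [← inner_conj_symm z (b i), mul_comm, Complex.mul_conj, Complex.ofReal_re,
      Complex.normSq_eq_norm_sq]
  have h1 : ‖x‖ ^ 2 ≤ (ε * ‖y‖) ^ 2 := by
    rw [mul_pow]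
    refine hasSum_le (fun i => ?_) (key x) ((key y).mul_left (ε ^ 2))
    rw [← mul_pow]
    exact pow_le_pow_left₀ (norm_nonneg _) (h i) 2
  exact abs_le_of_sq_le_sq' h1 (by positivity) |>.2

/-- The finite-rank truncations converge in operator norm: by Parseval the error is controlled by
the tail of `μ`. -/
theorem HilbertBasis.isCompactOperator_of_diagonal {E : Type*} [NormedAddCommGroup E]
    [InnerProductSpace ℂ E] [CompleteSpace E] (b : HilbertBasis ℕ ℂ E) (K : E →L[ℂ] E) (μ : ℕ → ℂ)
    (hμ : Tendsto μ atTop (𝓝 0)) (h : ∀ j u, inner ℂ (b j) (K u) = μ j * inner ℂ (b j) u) :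
    IsCompactOperator K := by
  let F : ℕ → E →L[ℂ] E := fun n =>
    ∑ j ∈ Finset.range n, (innerSL ℂ (b j)).smulRight (μ j • b j)
  have hF : ∀ n, IsCompactOperator (F n) := fun n =>
    (compactOperator (RingHom.id ℂ) E E).sum_mem fun j _ => isCompactOperator_smulRight _ _
  have hin : ∀ n i u, inner ℂ (b i) (F n u) = if i < n then μ i * inner ℂ (b i) u else 0 := by
    intro n i u
    simp only [F, sum_apply, ContinuousLinearMap.smulRight_apply,
      innerSL_apply_apply, inner_sum, inner_smul_right, orthonormal_iff_ite.1 b.orthonormal]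
    simp [mul_comm]
  have ht : Tendsto F atTop (𝓝 K) := by
    rw [Metric.tendsto_atTop]
    intro ε hε
    obtain ⟨N, hN⟩ := Metric.tendsto_atTop.1 hμ (ε / 2) (by positivity)
    refine ⟨N, fun n hn => ?_⟩
    rw [dist_eq_norm]
    refine lt_of_le_of_lt (ContinuousLinearMap.opNorm_le_bound _ (half_pos hε).le fun u => ?_)
      (half_lt_self hε)
    refine HilbertBasis.norm_le_of_inner_le b (half_pos hε).le fun i => ?_
    rw [sub_apply, inner_sub_right, hin, h]
    split_ifs with hi
    · rw [sub_self, norm_zero]; positivity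
    · rw [zero_sub, norm_neg, norm_mul]
      have := hN i (hn.trans (not_lt.1 hi))
      rw [dist_zero_right] at this
      gcongr
  exact isCompactOperator_of_tendsto ht (Eventually.of_forall hF)

end PolyGauss

/-! ### Compact inverses and spectral projections of the two oscillators -/

theorem eigFun_ne_zero (α β : ℝ) (k : ℕ) : eigFun α β k ≠ 0 := by
  intro h
  have := biorthogonal_eigFun α β k k
  rw [h, map_zero, if_pos rfl] at this
  exact zero_ne_one this

theorem tendsto_inv_eigval (α β : ℝ) : Tendsto (fun k => (eigval α β k)⁻¹) atTop (𝓝 0) := by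
  have h : Tendsto (fun k : ℕ => (1 + 2 * k + α ^ 2 + β ^ 2 : ℝ)⁻¹) atTop (𝓝 0) := by
    refine tendsto_inv_atTop_zero.comp (tendsto_atTop_mono (fun k => ?_)
      tendsto_natCast_atTop_atTop)
    nlinarith [sq_nonneg α, sq_nonneg β, (Nat.cast_nonneg k : (0 : ℝ) ≤ k)]
  have h2 := (Complex.continuous_ofReal.tendsto 0).comp h
  rw [Complex.ofReal_zero] at h2
  refine h2.congr fun k => ?_
  rw [Function.comp, Complex.ofReal_inv, eigval_eq_ofReal]

/-- For `α = β = 0` the eigenfunctions coincide with their duals, so after normalization they form a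
Hilbert basis that diagonalizes the inverse. -/
theorem exists_compact_inverse_oscT :
    ∃ K : L2R →L[ℂ] L2R, IsInverseOf K oscT ∧ IsCompactOperator K := by
  obtain ⟨K, hK, hterms⟩ := exists_inverse (A := oscT) (α := 0) (β := 0)
    fun f u => maps_oscT_iff_oscRel
  refine ⟨K, hK, ?_⟩
  have hdual : ∀ k, dualFun 0 0 k = eigFun 0 0 k := fun k => by rw [dualFun_eq, neg_zero]
  set e : ℕ → L2R := fun k => ((‖eigFun 0 0 k‖ : ℂ)⁻¹) • eigFun 0 0 k with he
  have ho : Orthonormal ℂ e := by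
    refine ⟨fun k => norm_smul_inv_norm (eigFun_ne_zero 0 0 k), fun j k hjk => ?_⟩
    change inner ℂ (e j) (e k) = 0
    rw [he, inner_smul_left, inner_smul_right, ← hdual j, inner_dualFun_eigFun, if_neg hjk,
      mul_zero, mul_zero]
  have hb : (Submodule.span ℂ (Set.range e))ᗮ = ⊥ := by
    rw [Submodule.eq_bot_iff]
    intro f hf
    refine eq_zero_of_inner_dualFun (α := 0) (β := 0) fun k => ?_
    have h1 := (Submodule.mem_orthogonal _ _).1 hf (e k) (Submodule.subset_span ⟨k, rfl⟩)
    rw [he, inner_smul_left, mul_eq_zero] at h1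
    rw [hdual]
    refine h1.resolve_left ?_
    simpa using eigFun_ne_zero 0 0 k
  refine HilbertBasis.isCompactOperator_of_diagonal (HilbertBasis.mkOfOrthogonalEqBot ho hb) K
    _ (tendsto_inv_eigval 0 0) fun j u => ?_
  obtain ⟨f₁, f₂, v, w, ht, -⟩ := hterms u
  have h2 := inner_dualFun ⟨_, _, _, _, ht⟩ j
  rw [HilbertBasis.coe_mkOfOrthogonalEqBot, he, inner_smul_left, inner_smul_left, ← hdual, h2]
  have := eigval_ne_zero 0 0 j
  field_simp

theorem exists_biorthogonalSystem {α β : ℝ} {A : L2R →ₗ.[ℂ] L2R}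
    (hA : ∀ f u, Maps A f u ↔ OscRel α β f u) :
    ∃ K, BiorthogonalSystem A K (eigFun α β) (dualFunctional α β) (eigval α β) := by
  obtain ⟨K, hK, hterms⟩ := exists_inverse hA
  obtain ⟨K₀, hK₀, hc⟩ := exists_compact_inverse_oscT
  refine ⟨K, hK, ?_, ?_, eigval_ne_zero α β, ?_, ?_, biorthogonal_eigFun α β, ?_⟩
  · choose f₁ f₂ v w ht bf bv using hterms
    have hmaps : ∀ u, Maps oscT (K u) (-f₂ u + w u) := fun u => OscTerms.oscT_eq (ht u)
    have hd : ∀ u, K u ∈ oscT.domain := fun u => (hmaps u).1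
    let T₀ : L2R →ₗ[ℂ] L2R := oscT.toFun ∘ₗ (K : L2R →ₗ[ℂ] L2R).codRestrict oscT.domain hd
    have hT₀ : ∀ u, T₀ u = -f₂ u + w u := fun u => (hmaps u).2
    have hbound : ∀ u, ‖T₀ u‖ ≤ (1 + 2 * |α| + 2 * |β|) * ‖u‖ := by
      intro u
      have e : T₀ u = u - (2 * Complex.I * (α : ℂ)) • v u - (2 * (β : ℂ)) • f₁ u := by
        rw [hT₀]
        nth_rewrite 3 [(ht u).eq]
        abel
      rw [e]
      have n1 : ‖(2 * Complex.I * (α : ℂ)) • v u‖ ≤ 2 * |α| * ‖u‖ := by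
        rw [norm_smul, norm_mul, norm_mul, Complex.norm_I, Complex.norm_real, Complex.norm_ofNat,
          Real.norm_eq_abs, mul_one]
        gcongr
        exact bv u
      have n2 : ‖(2 * (β : ℂ)) • f₁ u‖ ≤ 2 * |β| * ‖u‖ := by
        rw [norm_smul, norm_mul, Complex.norm_real, Complex.norm_ofNat, Real.norm_eq_abs]
        gcongr
        exact bf u
      have := norm_sub_le (u - (2 * Complex.I * (α : ℂ)) • v u) ((2 * (β : ℂ)) • f₁ u)
      have := norm_sub_le u ((2 * Complex.I * (α : ℂ)) • v u)
      linarith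
    -- Compactness is transported through `K = T⁻¹ (T K)`, where `T K u = u - 2iα xf - 2β f'` is
    -- bounded by the first-order estimates.
    have hcomp : (K : L2R → L2R) = K₀ ∘ (T₀.mkContinuous _ hbound) := by
      ext1 u
      exact (hK₀.2 ⟨K u, hd u⟩).symm
    rw [hcomp]
    exact hc.comp_clm _
  · intro j k h
    simp only [eigval_eq_ofReal, Complex.ofReal_inj] at h
    have : (j : ℝ) = k := by linarith
    exact_mod_cast this
  · exact fun j => (hA _ _).2 (oscRel_eigFun α β j)
  · intro j f
    rw [dualFunctional_apply, dualFunctional_apply, inner_dualFun ((hA _ _).1 ⟨f.2, rfl⟩)]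
    ring
  · intro f hf
    refine eq_zero_of_inner_dualFun (α := α) (β := β) fun k => ?_
    have h1 := hf k
    rw [dualFunctional_apply, mul_eq_zero] at h1
    refine h1.resolve_left (inv_ne_zero (Complex.ofReal_ne_zero.2 (by positivity)))

/-- Spectral data of `L` and `L̃`: simple eigenvalues and the norms of the spectral projections. -/
theorem exists_spectralProjections {a : ℝ} {A : L2R →ₗ.[ℂ] L2R}
    (hA : A = oscL a ∨ A = oscLTilde a) : ∃ P : ℕ → (L2R →L[ℂ] L2R),
      (∀ k, IsEigenvalue A (eigenval a k) ∧
        (∀ Q, IsSpectralProjection A (eigenval a k) Q ↔ Q = P k) ∧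
        Module.finrank ℂ (P k).range = 1) ∧
      ∀ k, ‖P k‖ = Real.exp (a ^ 2) * laguerreNeg k (2 * a ^ 2) := by
  obtain ⟨α, β, hαβ, hA'⟩ : ∃ α β : ℝ, α ^ 2 + β ^ 2 = a ^ 2 ∧
      ∀ f u, Maps A f u ↔ OscRel α β f u := by
    rcases hA with rfl | rfl
    · exact ⟨a, 0, by ring, fun f u => maps_oscL⟩
    · exact ⟨0, a, by ring, fun f u => maps_oscLTilde⟩
  have hev : ∀ k, eigenval a k = eigval α β k := by
    intro k
    rw [eigenval, eigval, add_assoc _ ((α : ℂ) ^ 2)]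
    congr 1
    exact_mod_cast hαβ.symm
  obtain ⟨K, hS⟩ := exists_biorthogonalSystem hA'
  refine ⟨BiorthogonalSystem.proj (eigFun α β) (dualFunctional α β), fun k => ?_, fun k => ?_⟩
  · rw [hev]
    -- Consecutive eigenvalues are 2 apart, so radius 1 is admissible.
    refine ⟨hS.isEigenvalue k, fun Q => hS.isSpectralProjection_iff k one_pos (fun j hj => ?_) Q,
      hS.finrank_range_proj k⟩
    have e : eigval α β j - eigval α β k = ((2 * ((j : ℤ) - k : ℤ) : ℝ) : ℂ) := by
      rw [eigval, eigval]; push_cast; ring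
    have h1 : (1 : ℝ) ≤ |(((j : ℤ) - k : ℤ) : ℝ)| := by
      have : (1 : ℤ) ≤ |(j : ℤ) - k| := Int.one_le_abs (by omega)
      exact_mod_cast this
    rw [Complex.dist_eq, e, Complex.norm_real, Real.norm_eq_abs, abs_mul, abs_two]
    linarith
  · rw [norm_proj_eigFun, hαβ]

/-! ## Laguerre polynomials at negative arguments -/

theorem integral_exp_int_mul (k : ℤ) :
    ∫ θ in -π..π, Complex.exp (k * (θ * Complex.I)) = if k = 0 then 2 * (π : ℂ) else 0 := by
  split_ifs with hk
  · subst hk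
    simp
    ring
  · have hc : (k : ℂ) * Complex.I ≠ 0 := mul_ne_zero (Int.cast_ne_zero.2 hk) Complex.I_ne_zero
    have h1 : ∀ θ : ℝ, Complex.exp (k * (θ * Complex.I)) = Complex.exp ((k * Complex.I) * θ) :=
      fun θ => by ring_nf
    simp only [h1]
    rw [integral_exp_mul_complex hc, div_eq_zero_iff]
    left
    have h2 : (k : ℂ) * Complex.I * (π : ℝ) = k * Complex.I * ((-π : ℝ) : ℂ) +
        k * (2 * π * Complex.I) := by push_cast; ring
    rw [h2, Complex.exp_add, Complex.exp_int_mul_two_pi_mul_I, mul_one, sub_self]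

theorem integral_exp_exp_mul (s : ℝ) (m : ℕ) :
    ∫ θ in -π..π, Complex.exp (s * Complex.exp (θ * Complex.I)) *
      Complex.exp (-(θ * Complex.I)) ^ m = 2 * (π : ℂ) * (s ^ m / m.factorial) := by
  have hnorm : ∀ θ : ℝ, ‖Complex.exp (-(θ * Complex.I))‖ = 1 := fun θ => by
    rw [← neg_mul, ← Complex.ofReal_neg, Complex.norm_exp_ofReal_mul_I]
  have hs := intervalIntegral.hasSum_integral_of_dominated_convergence (μ := volume) (a := -π)
    (b := π) (F := fun (j : ℕ) (θ : ℝ) => (s * Complex.exp (θ * Complex.I)) ^ j / j.factorial *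
      Complex.exp (-(θ * Complex.I)) ^ m)
    (f := fun θ : ℝ => Complex.exp (s * Complex.exp (θ * Complex.I)) *
      Complex.exp (-(θ * Complex.I)) ^ m)
    (fun j _ => |s| ^ j / j.factorial) (fun j => ?_) (fun j => ?_) ?_ ?_ ?_
  · have hterm : ∀ j : ℕ, (∫ θ in -π..π, (s * Complex.exp (θ * Complex.I)) ^ j / j.factorial *
        Complex.exp (-(θ * Complex.I)) ^ m) =
        if j = m then 2 * (π : ℂ) * (s ^ m / m.factorial) else 0 := by
      intro j
      have h1 : ∀ θ : ℝ, (s * Complex.exp (θ * Complex.I)) ^ j / j.factorial *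
          Complex.exp (-(θ * Complex.I)) ^ m =
          (s ^ j / j.factorial) * Complex.exp (((j : ℤ) - m : ℤ) * (θ * Complex.I)) := by
        intro θ
        rw [mul_pow, ← Complex.exp_nat_mul, ← Complex.exp_nat_mul, div_mul_eq_mul_div, mul_assoc,
          ← Complex.exp_add, mul_div_right_comm]
        congr 2
        push_cast; ring
      simp only [h1]
      rw [intervalIntegral.integral_const_mul, integral_exp_int_mul]
      have : ((j : ℤ) - m = 0) ↔ j = m := by omega
      simp only [this]
      split_ifs with h
      · subst h; ring
      · rw [mul_zero]
    simp only [hterm] at hs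
    exact hs.unique (hasSum_ite_eq m _)
  · exact Continuous.aestronglyMeasurable (by fun_prop)
  · refine ae_of_all _ fun θ _ => le_of_eq ?_
    rw [norm_mul, norm_pow _ m, hnorm, one_pow, mul_one, norm_div, norm_pow, norm_mul,
      Complex.norm_real, Complex.norm_exp_ofReal_mul_I, mul_one, Complex.norm_natCast,
      Real.norm_eq_abs]
  · exact ae_of_all _ fun θ _ => Real.summable_pow_div_factorial _
  · exact intervalIntegrable_const
  · refine ae_of_all _ fun θ _ => ?_
    have h1 := (NormedSpace.expSeries_div_hasSum_exp
      ((s * Complex.exp (θ * Complex.I) : ℂ))).mul_right (Complex.exp (-(θ * Complex.I)) ^ m)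
    rwa [← Complex.exp_eq_exp_ℂ] at h1

/-- The binomial expansion is paired with the Fourier coefficients `s^m / m!` of `exp(s e^{iθ})`.
Only the product `qs` matters for the value, which leaves a free scale to balance the two factors.
-/
theorem laguerreNeg_eq_integral (n : ℕ) (q s : ℝ) :
    2 * (π : ℂ) * (laguerreNeg n (q * s) : ℝ) = ∫ θ in -π..π,
      Complex.exp (s * Complex.exp (θ * Complex.I)) *
        (1 + q * Complex.exp (-(θ * Complex.I))) ^ n := by
  have h1 : ∀ θ : ℝ, Complex.exp (s * Complex.exp (θ * Complex.I)) *
        (1 + q * Complex.exp (-(θ * Complex.I))) ^ n =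
      ∑ m ∈ Finset.range (n + 1), ((n.choose m : ℂ) * q ^ m) *
        (Complex.exp (s * Complex.exp (θ * Complex.I)) * Complex.exp (-(θ * Complex.I)) ^ m) := by
    intro θ
    rw [add_comm, add_pow, Finset.mul_sum]
    refine Finset.sum_congr rfl fun m _ => ?_
    rw [one_pow, mul_pow]; ring
  simp only [h1]
  rw [intervalIntegral.integral_finsetSum fun m _ =>
    Continuous.intervalIntegrable (by fun_prop) _ _]
  simp only [intervalIntegral.integral_const_mul, integral_exp_exp_mul]
  rw [laguerreNeg, Complex.ofReal_sum, Finset.mul_sum]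
  refine Finset.sum_congr rfl fun m _ => ?_
  push_cast
  rw [mul_pow]; ring

/-- With `nq = s` and `sq = y`, the linear term of `n log(1 + q e^{-iθ})` is `s e^{-iθ}`, which
combines with `s e^{iθ}` to `2s cos θ`. The quadratic term is `-(y/2) e^{-2iθ}`, and the remainder
is at most `n q³ = yq`. -/
theorem norm_exp_mul_one_add_pow_sub_le {y q s : ℝ} {n : ℕ} (hy : 0 ≤ y) (hq : 0 ≤ q)
    (hq2 : q ≤ 1 / 2) (hnq : n * q = s) (hsq : s * q = y) (hyq : y * q ≤ 1) (θ : ℝ) :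
    ‖Complex.exp (s * Complex.exp (θ * Complex.I)) *
        (1 + q * Complex.exp (-(θ * Complex.I))) ^ n -
      Real.exp (2 * s * Real.cos θ) *
        Complex.exp (-(y / 2) * Complex.exp (-(θ * Complex.I)) ^ 2)‖ ≤
      Real.exp (2 * s * Real.cos θ) * (Real.exp (y / 2) * (2 * (y * q))) := by
  set w := Complex.exp (-(θ * Complex.I)) with hw
  have hw1 : ‖w‖ = 1 := by
    rw [hw, ← neg_mul, ← Complex.ofReal_neg, Complex.norm_exp_ofReal_mul_I]
  have hqw : ‖(q : ℂ) * w‖ = q := by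
    rw [norm_mul, hw1, mul_one, Complex.norm_real, Real.norm_eq_abs, abs_of_nonneg hq]
  have hlt : ‖(q : ℂ) * w‖ < 1 := by rw [hqw]; linarith
  set R := Complex.log (1 + q * w) - (q * w - (q * w) ^ 2 / 2) with hR
  have hRle : ‖R‖ ≤ q ^ 3 := by
    have h := Complex.norm_log_sub_logTaylor_le 2 hlt
    have e : Complex.logTaylor (2 + 1) (q * w) = q * w - (q * w) ^ 2 / 2 := by
      simp [Complex.logTaylor_succ, Complex.logTaylor_zero]
      ring
    rw [e, hqw] at h
    refine h.trans ?_
    have h2 : (1 - q)⁻¹ ≤ 2 := by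
      rw [inv_le_comm₀ (by linarith) two_pos]; linarith
    have h3 : 0 ≤ q ^ 3 := by positivity
    push_cast
    rw [div_le_iff₀ (by norm_num)]
    nlinarith [mul_le_mul_of_nonneg_left h2 h3]
  have hne : 1 + (q : ℂ) * w ≠ 0 := by
    intro h
    have : (q : ℂ) * w = -1 := by linear_combination h
    rw [this, norm_neg, norm_one] at hqw
    linarith
  have hnR : ‖(n : ℂ) * R‖ ≤ y * q := by
    rw [norm_mul, Complex.norm_natCast]
    calc (n : ℝ) * ‖R‖ ≤ n * q ^ 3 := by gcongr
      _ = y * q := by rw [← hsq, ← hnq]; ring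
  have hnqc : (n : ℂ) * q = s := by rw [← hnq]; push_cast; rfl
  have hsqc : (s : ℂ) * q = y := by rw [← hsq]; push_cast; rfl
  have hcos : Complex.exp (θ * Complex.I) + w = 2 * (Real.cos θ : ℝ) := by
    rw [Complex.ofReal_cos, Complex.cos, hw, neg_mul]; ring
  have hmain : Complex.exp (s * Complex.exp (θ * Complex.I)) * (1 + q * w) ^ n =
      Real.exp (2 * s * Real.cos θ) * Complex.exp (-(y / 2) * w ^ 2) * Complex.exp (n * R) := by
    rw [← Complex.exp_log hne, ← Complex.exp_nat_mul, ← Complex.exp_add, Complex.ofReal_exp,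
      ← Complex.exp_add, ← Complex.exp_add]
    congr 1
    rw [hR]
    push_cast
    rw [Complex.ofReal_cos] at hcos
    linear_combination (s : ℂ) * hcos + (w - q * w ^ 2 / 2) * hnqc - w ^ 2 / 2 * hsqc
  have hyw : ‖Complex.exp (-(y / 2) * w ^ 2)‖ ≤ Real.exp (y / 2) := by
    refine (Complex.norm_exp_le_exp_norm _).trans (Real.exp_le_exp.2 ?_)
    rw [norm_mul, norm_pow, hw1, one_pow, mul_one, norm_neg, norm_div, Complex.norm_real,
      Real.norm_eq_abs, abs_of_nonneg hy, Complex.norm_ofNat]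
  rw [hmain, ← mul_sub_one, norm_mul, norm_mul, Complex.norm_real, Real.norm_eq_abs,
    abs_of_pos (Real.exp_pos _), mul_assoc]
  gcongr
  exact (Complex.norm_exp_sub_one_le (hnR.trans hyq)).trans (by linarith)

/-- The real part is even in `θ`, so freezing it at `θ = 0` costs only second order. The factor
`sin² θ` is what gains `1/r` after integration against `exp(r cos θ)`; the imaginary part would be
of first order. -/
theorem abs_re_exp_sub_le {y : ℝ} (hy : 0 ≤ y) (θ : ℝ) :
    |(Complex.exp (-(y / 2) * Complex.exp (-(θ * Complex.I)) ^ 2)).re - Real.exp (-(y / 2))| ≤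
      Real.exp y * (y + y ^ 2 / 2) * Real.sin θ ^ 2 := by
  have e1 : -((y : ℂ) / 2) * Complex.exp (-(θ * Complex.I)) ^ 2 =
      ((-(y / 2) * Real.cos (2 * θ) : ℝ) : ℂ) + ((y / 2 * Real.sin (2 * θ) : ℝ) : ℂ) * Complex.I := by
    rw [← Complex.exp_nat_mul]
    have : ((2 : ℕ) : ℂ) * -(θ * Complex.I) = ((-(2 * θ) : ℝ) : ℂ) * Complex.I := by
      push_cast; ring
    rw [this, Complex.exp_mul_I, ← Complex.ofReal_cos, ← Complex.ofReal_sin, Real.cos_neg,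
      Real.sin_neg]
    push_cast; ring
  have hs0 := sq_nonneg (Real.sin θ)
  have hs1 : Real.sin θ ^ 2 ≤ 1 := Real.sin_sq_le_one θ
  set S := Real.sin θ ^ 2 with hS
  have e2 : -(y / 2) * Real.cos (2 * θ) = -(y / 2) + y * S := by
    rw [Real.cos_two_mul, Real.cos_sq']; ring
  rw [e1, Complex.exp_re]
  simp only [Complex.add_re, Complex.ofReal_re, Complex.re_ofReal_mul, Complex.I_re, mul_zero,
    add_zero, Complex.add_im, Complex.ofReal_im, Complex.im_ofReal_mul, Complex.I_im, mul_one,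
    zero_add]
  rw [e2, Real.exp_add]
  set t := y / 2 * Real.sin (2 * θ) with ht
  have ht2 : t ^ 2 ≤ y ^ 2 * S := by
    rw [ht, Real.sin_two_mul]
    have : (y / 2 * (2 * Real.sin θ * Real.cos θ)) ^ 2 = y ^ 2 * S * Real.cos θ ^ 2 := by
      rw [hS]; ring
    rw [this]
    exact mul_le_of_le_one_right (by positivity) (Real.cos_sq_le_one θ)
  have hyS : 0 ≤ y * S := mul_nonneg hy hs0
  have h1 : Real.exp (y * S) - 1 ≤ Real.exp y * (y * S) := by
    have ha : 1 - y * S ≤ Real.exp (-(y * S)) := by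
      have := Real.add_one_le_exp (-(y * S)); linarith
    have hb : Real.exp (y * S) ≤ Real.exp y := Real.exp_le_exp.2 (mul_le_of_le_one_right hy hs1)
    have hc : Real.exp (y * S) * Real.exp (-(y * S)) = 1 := by rw [← Real.exp_add]; simp
    nlinarith [Real.exp_pos (y * S)]
  have h1' : 1 ≤ Real.exp (y * S) := Real.one_le_exp hyS
  have h1'' : 1 ≤ Real.exp y := Real.one_le_exp hy
  have h2 : 1 - t ^ 2 / 2 ≤ Real.cos t := Real.one_sub_sq_div_two_le_cos
  have h3 := Real.cos_le_one t
  have h4 : Real.exp (-(y / 2)) ≤ 1 := Real.exp_le_one_iff.2 (by linarith)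
  have h5 := Real.exp_pos (-(y / 2))
  have hb : Real.exp (y * S) ≤ Real.exp y := Real.exp_le_exp.2 (mul_le_of_le_one_right hy hs1)
  have key : |Real.exp (y * S) * Real.cos t - 1| ≤ Real.exp y * (y + y ^ 2 / 2) * S := by
    have hy2 : 0 ≤ y ^ 2 * S := by positivity
    rw [abs_le]
    constructor
    · nlinarith [mul_le_mul_of_nonneg_left h2 (Real.exp_pos (y * S)).le,
        mul_le_mul_of_nonneg_left ht2 (Real.exp_pos (y * S)).le,
        mul_le_mul_of_nonneg_right hb hy2, mul_nonneg (Real.exp_pos y).le hyS]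
    · nlinarith [mul_le_mul_of_nonneg_left h3 (Real.exp_pos (y * S)).le,
        mul_nonneg (Real.exp_pos y).le hy2]
  have e3 : Real.exp (-(y / 2)) * Real.exp (y * S) * Real.cos t - Real.exp (-(y / 2)) =
      Real.exp (-(y / 2)) * (Real.exp (y * S) * Real.cos t - 1) := by ring
  rw [e3, abs_mul, abs_of_pos h5]
  exact (mul_le_of_le_one_left (abs_nonneg _) h4).trans key

/-- The Bessel integral `2π I₀(r)`. -/
noncomputable def besselInt (r : ℝ) : ℝ := ∫ θ in -π..π, Real.exp (r * Real.cos θ)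

theorem besselInt_pos (r : ℝ) : 0 < besselInt r :=
  intervalIntegral.intervalIntegral_pos_of_pos
    (Continuous.intervalIntegrable (by fun_prop) _ _) (fun _ => Real.exp_pos _)
    (by linarith [Real.pi_pos])

/-- Integrating `sin θ · (exp(r cos θ) sin θ)` by parts gives `r⁻¹ ∫ exp(r cos θ) cos θ`, and `cos θ
≤ 1`. -/
theorem integral_exp_mul_sin_sq_le {r : ℝ} (hr : 0 < r) :
    ∫ θ in -π..π, Real.exp (r * Real.cos θ) * Real.sin θ ^ 2 ≤ besselInt r / r := by
  have hu : ∀ θ ∈ Set.uIcc (-π) π, HasDerivAt Real.sin (Real.cos θ) θ :=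
    fun θ _ => Real.hasDerivAt_sin θ
  have hv : ∀ θ ∈ Set.uIcc (-π) π, HasDerivAt (fun θ => -Real.exp (r * Real.cos θ) / r)
      (Real.exp (r * Real.cos θ) * Real.sin θ) θ := by
    intro θ _
    have := (((Real.hasDerivAt_cos θ).const_mul r).exp.neg).div_const r
    refine this.congr_deriv ?_
    field_simp
  have h := intervalIntegral.integral_mul_deriv_eq_deriv_mul hu hv
    (Continuous.intervalIntegrable (by fun_prop) _ _)
    (Continuous.intervalIntegrable (by fun_prop) _ _)
  have e : ∀ θ, Real.exp (r * Real.cos θ) * Real.sin θ ^ 2 =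
      Real.sin θ * (Real.exp (r * Real.cos θ) * Real.sin θ) := fun θ => by ring
  simp only [e]
  rw [h, Real.sin_pi, Real.sin_neg, Real.sin_pi, neg_zero, zero_mul, zero_mul, sub_zero, zero_sub,
    ← intervalIntegral.integral_neg, besselInt, ← intervalIntegral.integral_div]
  refine intervalIntegral.integral_mono_on (by linarith [Real.pi_pos])
    (Continuous.intervalIntegrable (by fun_prop) _ _)
    (Continuous.intervalIntegrable (by fun_prop) _ _) fun θ _ => ?_
  rw [← mul_neg, neg_div, neg_neg, ← mul_div_assoc]
  gcongr
  exact mul_le_of_le_one_left (Real.exp_pos _).le (Real.cos_le_one θ)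

/-- The contour integral is real, so only real parts are compared. Both errors carry the positive
weight `exp(2s cos θ)`, hence are relative to the Bessel integral. -/
theorem abs_laguerreNeg_sub_le {y q s : ℝ} {n : ℕ} (hy : 0 ≤ y) (hq : 0 ≤ q)
    (hq2 : q ≤ 1 / 2) (hnq : n * q = s) (hsq : s * q = y) (hyq : y * q ≤ 1) (hs : 0 < s) :
    |2 * π * laguerreNeg n y - Real.exp (-(y / 2)) * besselInt (2 * s)| ≤
      besselInt (2 * s) *
        (Real.exp (y / 2) * (2 * (y * q)) + Real.exp y * (y + y ^ 2 / 2) / (2 * s)) := by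
  set D := Real.exp (y / 2) * (2 * (y * q)) with hD
  set M := Real.exp y * (y + y ^ 2 / 2) with hM
  set F : ℝ → ℂ := fun θ => Complex.exp (s * Complex.exp (θ * Complex.I)) *
        (1 + q * Complex.exp (-(θ * Complex.I))) ^ n with hF
  have hcF : Continuous F := by fun_prop
  have h1 : 2 * π * laguerreNeg n y = ∫ θ in -π..π, (F θ).re := by
    have h2 := Complex.reCLM.intervalIntegral_comp_comm (hcF.intervalIntegrable (μ := volume) (-π) π)
    rw [← laguerreNeg_eq_integral, mul_comm q, hsq] at h2
    simp only [Complex.reCLM_apply] at h2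
    rw [h2]
    have : 2 * (π : ℂ) * ((laguerreNeg n y : ℝ) : ℂ) = ((2 * π * laguerreNeg n y : ℝ) : ℂ) := by
      push_cast; rfl
    rw [this, Complex.ofReal_re]
  have hcr : Continuous fun θ => (F θ).re := Complex.continuous_re.comp hcF
  have hce : Continuous fun θ => Real.exp (-(y / 2)) * Real.exp (2 * s * Real.cos θ) := by fun_prop
  rw [h1, besselInt, ← intervalIntegral.integral_const_mul, ← intervalIntegral.integral_sub
    (hcr.intervalIntegrable _ _) (hce.intervalIntegrable _ _), ← Real.norm_eq_abs]
  refine (intervalIntegral.norm_integral_le_of_norm_le (g := fun θ =>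
    Real.exp (2 * s * Real.cos θ) * D + M * (Real.exp (2 * s * Real.cos θ) * Real.sin θ ^ 2))
    (by linarith [Real.pi_pos]) (ae_of_all _ fun θ _ => ?_)
    (Continuous.intervalIntegrable (by fun_prop) _ _)).trans ?_
  · have a1 := norm_exp_mul_one_add_pow_sub_le hy hq hq2 hnq hsq hyq θ
    have a2 := abs_re_exp_sub_le hy θ
    set G := Complex.exp (-((y : ℂ) / 2) * Complex.exp (-(θ * Complex.I)) ^ 2) with hG
    have a3 := (Complex.abs_re_le_norm _).trans a1
    rw [Complex.sub_re, Complex.re_ofReal_mul] at a3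
    have e : (F θ).re - Real.exp (-(y / 2)) * Real.exp (2 * s * Real.cos θ) =
      ((F θ).re - Real.exp (2 * s * Real.cos θ) * G.re) +
        Real.exp (2 * s * Real.cos θ) * (G.re - Real.exp (-(y / 2))) := by ring
    rw [Real.norm_eq_abs, e]
    refine (abs_add_le _ _).trans (add_le_add a3 ?_)
    rw [abs_mul, abs_of_pos (Real.exp_pos _)]
    calc _ ≤ Real.exp (2 * s * Real.cos θ) * (M * Real.sin θ ^ 2) := by gcongr
      _ = _ := by ring
  · rw [intervalIntegral.integral_add (Continuous.intervalIntegrable (by fun_prop) _ _)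
      (Continuous.intervalIntegrable (by fun_prop) _ _), intervalIntegral.integral_mul_const,
      intervalIntegral.integral_const_mul, mul_add]
    refine add_le_add le_rfl ?_
    have hM0 : 0 ≤ M := by positivity
    calc _ ≤ M * (besselInt (2 * s) / (2 * s)) := by
          gcongr
          exact integral_exp_mul_sin_sq_le (by positivity)
      _ = _ := by rw [besselInt]; ring

/-! ## Laplace's method for the Bessel integral -/

theorem integral_sq_mul_exp_neg {b : ℝ} (hb : 0 < b) :
    ∫ x : ℝ, x ^ 2 * Real.exp (-b * x ^ 2) =
      (b * √b)⁻¹ * ∫ x : ℝ, x ^ 2 * Real.exp (-x ^ 2) := by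
  have h := Measure.integral_comp_mul_left (fun x : ℝ => x ^ 2 * Real.exp (-x ^ 2)) (√b)
  have e : ∀ x : ℝ, (√b * x) ^ 2 * Real.exp (-(√b * x) ^ 2) =
      b * (x ^ 2 * Real.exp (-b * x ^ 2)) := by
    intro x
    rw [mul_pow, Real.sq_sqrt hb.le]; ring_nf
  simp only [e] at h
  rw [integral_const_mul, smul_eq_mul, abs_of_pos (by positivity)] at h
  rw [mul_inv, mul_assoc, ← h, inv_mul_cancel_left₀ hb.ne']

theorem integrable_sq_mul_exp_neg {b : ℝ} (hb : 0 < b) :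
    Integrable fun x : ℝ => x ^ 2 * Real.exp (-b * x ^ 2) := by
  simpa using integrable_rpow_mul_exp_neg_mul_sq hb (s := 2) (by norm_num)

/-- The half-angle formula `cos θ = 1 - 2 sin²(θ/2)` extracts the maximum `e^r` and leaves a peak at
the centre of the interval. -/
theorem besselInt_eq (r : ℝ) :
    besselInt r = 2 * Real.exp r * ∫ φ in -(π / 2)..π / 2, Real.exp (-(2 * r) * Real.sin φ ^ 2) := by
  have h := intervalIntegral.integral_comp_div (a := -π) (b := π)
    (fun φ => Real.exp (-(2 * r) * Real.sin φ ^ 2)) (two_ne_zero (α := ℝ))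
  rw [smul_eq_mul, neg_div] at h
  rw [mul_comm 2, mul_assoc, ← h, ← intervalIntegral.integral_const_mul, besselInt]
  refine intervalIntegral.integral_congr fun θ _ => ?_
  rw [← Real.exp_add]
  congr 1
  have : Real.cos θ = 1 - 2 * Real.sin (θ / 2) ^ 2 := by
    rw [← Real.cos_sq_add_sin_sq (θ / 2)]
    have := Real.cos_two_mul (θ / 2)
    rw [mul_div_cancel₀ _ (two_ne_zero)] at this
    have h2 := Real.cos_sq_add_sin_sq (θ / 2)
    linarith
  rw [this]; ring

theorem integral_cos_mul_exp (b : ℝ) :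
    ∫ φ in -(π / 2)..π / 2, Real.exp (-b * Real.sin φ ^ 2) * Real.cos φ =
      ∫ u in (-1 : ℝ)..1, Real.exp (-b * u ^ 2) := by
  have h := intervalIntegral.integral_comp_mul_deriv (a := -(π / 2)) (b := π / 2)
    (f := Real.sin) (f' := Real.cos) (g := fun u => Real.exp (-b * u ^ 2))
    (fun x _ => Real.hasDerivAt_sin x) Real.continuous_cos.continuousOn (by fun_prop)
  rw [Real.sin_neg, Real.sin_pi_div_two] at h
  exact h

/-- The discarded tail lies where `x² ≥ 1`, so it is bounded by the second moment, of order
`b^{-3/2}`. -/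
theorem abs_integral_gauss_sub_le {b : ℝ} (hb : 0 < b) :
    |(∫ u in (-1 : ℝ)..1, Real.exp (-b * u ^ 2)) - √(π / b)| ≤
      ∫ x : ℝ, x ^ 2 * Real.exp (-b * x ^ 2) := by
  have hi := integrable_exp_neg_mul_sq hb
  rw [← integral_gaussian, intervalIntegral.integral_of_le (by norm_num),
    ← integral_add_compl (measurableSet_Ioc (a := (-1 : ℝ)) (b := 1)) hi, sub_add_cancel_left,
    abs_neg, abs_of_nonneg (integral_nonneg fun x => (Real.exp_pos _).le)]
  refine (setIntegral_mono_on hi.integrableOn (integrable_sq_mul_exp_neg hb).integrableOn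
    measurableSet_Ioc.compl fun x hx => ?_).trans
    (setIntegral_le_integral (integrable_sq_mul_exp_neg hb) (ae_of_all _ fun x => by positivity))
  have h1 : 1 ≤ x ^ 2 := by
    by_contra hlt
    push Not at hlt
    have := abs_lt_of_sq_lt_sq' (a := x) (b := 1) (by rwa [one_pow]) zero_le_one
    exact hx ⟨this.1, this.2.le⟩
  nlinarith [Real.exp_pos (-b * x ^ 2)]

/-- Combines `1 - cos φ ≤ φ²` with Jordan's inequality `|sin φ| ≥ (2/π)|φ|`, again leaving a
Gaussian second moment. -/
theorem abs_integral_one_sub_cos_le {b : ℝ} (hb : 0 < b) :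
    |∫ φ in -(π / 2)..π / 2, Real.exp (-b * Real.sin φ ^ 2) * (1 - Real.cos φ)| ≤
      ∫ x : ℝ, x ^ 2 * Real.exp (-(4 / π ^ 2 * b) * x ^ 2) := by
  have hb' : 0 < 4 / π ^ 2 * b := by positivity
  rw [← Real.norm_eq_abs]
  refine (intervalIntegral.norm_integral_le_of_norm_le (g := fun x =>
    x ^ 2 * Real.exp (-(4 / π ^ 2 * b) * x ^ 2)) (by linarith [Real.pi_pos])
    (ae_of_all _ fun φ hφ => ?_) (Continuous.intervalIntegrable (by fun_prop) _ _)).trans ?_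
  · have habs : |φ| ≤ π / 2 := abs_le.2 ⟨hφ.1.le, hφ.2⟩
    have hs := Real.mul_abs_le_abs_sin habs
    have hs2 : 4 / π ^ 2 * φ ^ 2 ≤ Real.sin φ ^ 2 := by
      rw [← sq_abs (Real.sin φ), ← sq_abs φ]
      calc 4 / π ^ 2 * |φ| ^ 2 = (2 / π * |φ|) ^ 2 := by ring
        _ ≤ _ := by gcongr
    have hc := Real.one_sub_sq_div_two_le_cos (x := φ)
    have hc1 := Real.cos_le_one φ
    rw [norm_mul, Real.norm_eq_abs, Real.norm_eq_abs, abs_of_pos (Real.exp_pos _),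
      abs_of_nonneg (by linarith), mul_comm]
    have h1 : 1 - Real.cos φ ≤ φ ^ 2 := by nlinarith [sq_nonneg φ]
    have h2 : Real.exp (-b * Real.sin φ ^ 2) ≤ Real.exp (-(4 / π ^ 2 * b) * φ ^ 2) := by
      rw [Real.exp_le_exp]; nlinarith
    exact mul_le_mul h1 h2 (Real.exp_pos _).le (sq_nonneg _)
  · rw [intervalIntegral.integral_of_le (by linarith [Real.pi_pos])]
    exact setIntegral_le_integral (integrable_sq_mul_exp_neg hb')
      (ae_of_all _ fun x => by positivity)

/-- Writing `1 = cos φ + (1 - cos φ)`, the first part becomes a truncated Gaussian under `u = sin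
φ`. With `b = 2r`, both errors are `O(b^{-3/2})` against the main term `√(π/b)`, hence of relative
size `1/r`. -/
theorem exists_abs_besselInt_sub_le : ∃ C : ℝ, 0 ≤ C ∧ ∀ r : ℝ, 0 < r →
    |besselInt r / (2 * π) * (√(2 * π * r) * Real.exp (-r)) - 1| ≤ C / r := by
  set m := ∫ x : ℝ, x ^ 2 * Real.exp (-x ^ 2) with hm
  have hm0 : 0 ≤ m := integral_nonneg fun x => by positivity
  set κ := 4 / π ^ 2 with hκ
  have hκ0 : 0 < κ := by positivity
  refine ⟨√(2 / π) * (m * (1 + (κ * √κ)⁻¹)) / (2 * √2), by positivity, fun r hr => ?_⟩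
  set b := 2 * r with hb
  have hb0 : 0 < b := by positivity
  set J := ∫ φ in -(π / 2)..π / 2, Real.exp (-b * Real.sin φ ^ 2) with hJ
  have hsplit : J = (∫ u in (-1 : ℝ)..1, Real.exp (-b * u ^ 2)) +
      ∫ φ in -(π / 2)..π / 2, Real.exp (-b * Real.sin φ ^ 2) * (1 - Real.cos φ) := by
    rw [← integral_cos_mul_exp, ← intervalIntegral.integral_add
      (Continuous.intervalIntegrable (by fun_prop) _ _)
      (Continuous.intervalIntegrable (by fun_prop) _ _)]
    refine intervalIntegral.integral_congr fun φ _ => ?_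
    ring
  have h1 := abs_integral_gauss_sub_le hb0
  have h2 := abs_integral_one_sub_cos_le hb0
  rw [integral_sq_mul_exp_neg hb0, ← hm] at h1
  rw [← hκ, integral_sq_mul_exp_neg (by positivity), ← hm, Real.sqrt_mul hκ0.le] at h2
  have h3 : |J - √(π / b)| ≤ (b * √b)⁻¹ * (m * (1 + (κ * √κ)⁻¹)) := by
    have e : J - √(π / b) = ((∫ u in (-1 : ℝ)..1, Real.exp (-b * u ^ 2)) - √(π / b)) +
      ∫ φ in -(π / 2)..π / 2, Real.exp (-b * Real.sin φ ^ 2) * (1 - Real.cos φ) := by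
      rw [hsplit]; ring
    rw [e]
    refine (abs_add_le _ _).trans ((add_le_add h1 h2).trans (le_of_eq ?_))
    have : (κ * b * (√κ * √b))⁻¹ = (b * √b)⁻¹ * (κ * √κ)⁻¹ := by
      rw [← mul_inv]; congr 1; ring
    rw [this]; ring
  have hsr := Real.sqrt_pos.2 hr
  have hsπ := Real.sqrt_pos.2 Real.pi_pos
  have hs2 : 0 < √2 := by positivity
  have q1 : √2 ^ 2 = 2 := Real.sq_sqrt zero_le_two
  have q2 : √π ^ 2 = π := Real.sq_sqrt Real.pi_pos.le
  have q3 : √r ^ 2 = r := Real.sq_sqrt hr.le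
  have e1 : besselInt r / (2 * π) * (√(2 * π * r) * Real.exp (-r)) - 1 =
      (√2 * √r / √π) * (J - √(π / b)) := by
    rw [besselInt_eq, ← hb, ← hJ, Real.exp_neg, Real.sqrt_mul (by positivity),
      Real.sqrt_mul zero_le_two, hb, Real.sqrt_div Real.pi_pos.le, Real.sqrt_mul zero_le_two]
    have := Real.exp_pos r
    field_simp
    linear_combination (J * √2 * √r) * q2
  rw [e1, abs_mul, abs_of_pos (by positivity)]
  calc _ ≤ (√2 * √r / √π) * ((b * √b)⁻¹ * (m * (1 + (κ * √κ)⁻¹))) := by gcongr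
    _ = _ := by
      rw [hb, Real.sqrt_mul zero_le_two, Real.sqrt_div zero_le_two]
      field_simp

/-! ## Asymptotics of the norms -/

theorem exists_abs_laguerre_ratio_sub_one_le {y : ℝ} (hy : 0 < y) : ∃ C : ℝ, ∀ᶠ n : ℕ in atTop,
    |Real.exp (y / 2) * laguerreNeg n y *
      (√(2 * π * (2 * (√n * √y))) * Real.exp (-(2 * (√n * √y)))) - 1| ≤ C * (√n)⁻¹ := by
  obtain ⟨C, hC, hB⟩ := exists_abs_besselInt_sub_le
  have hsy : 0 < √y := Real.sqrt_pos.2 hy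
  have hyy : √y * √y = y := Real.mul_self_sqrt hy.le
  set M := Real.exp y * (y + y ^ 2 / 2) with hM
  set c₁ := Real.exp (y / 2) * (Real.exp (y / 2) * (2 * (y * √y)) + M / (2 * √y)) with hc₁
  set c₂ := C / (2 * √y) with hc₂
  have hM0 : 0 ≤ M := by positivity
  have hc₁0 : 0 ≤ c₁ := by positivity
  have hc₂0 : 0 ≤ c₂ := by positivity
  have ht : Tendsto (fun n : ℕ => √y * (√n)⁻¹) atTop (𝓝 0) := by
    have h := (tendsto_inv_atTop_zero.comp (Real.tendsto_sqrt_atTop.comp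
      tendsto_natCast_atTop_atTop)).const_mul (√y)
    rw [mul_zero] at h
    exact h
  -- The ratio factors as `(1 + u)(1 + v)`, with `u` the Laguerre-to-Bessel error and `v` the
  -- Laplace error; `c₁c₂` absorbs `uv`, as `(√n)⁻¹ ≤ 1`.
  refine ⟨c₁ + c₂ + c₁ * c₂, ?_⟩
  filter_upwards [ht.eventually_le_const (show (0 : ℝ) < 1 / 2 by norm_num),
    ht.eventually_le_const (show 0 < y⁻¹ by positivity), eventually_ge_atTop 1]
    with n h1 h2 hn
  have hn0 : (1 : ℝ) ≤ n := by exact_mod_cast hn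
  have hsn : 1 ≤ √(n : ℝ) := Real.one_le_sqrt.2 hn0
  have hsn0 : 0 < √(n : ℝ) := by linarith
  have hnn : √(n : ℝ) * √n = n := Real.mul_self_sqrt (by linarith)
  set t := (√(n : ℝ))⁻¹ with htd
  have ht0 : 0 < t := by positivity
  have ht1 : t ≤ 1 := inv_le_one_of_one_le₀ hsn
  set s := √(n : ℝ) * √y with hs
  -- `s = √(ny)` and `q = √(y/n)` are the nonnegative solution of `nq = s`, `sq = y`; the two
  -- eventual conditions above say `q ≤ 1/2` and `yq ≤ 1`.
  set q := √y * t with hq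
  have hs0 : 0 < s := by positivity
  have hnt : √(n : ℝ) * t = 1 := mul_inv_cancel₀ hsn0.ne'
  have hnq : n * q = s := by rw [hq, hs]; linear_combination √(n : ℝ) * √y * hnt - √y * t * hnn
  have hsq : s * q = y := by rw [hq, hs]; linear_combination √y * √y * hnt + hyy
  have hyq : y * q ≤ 1 := by
    have := mul_le_mul_of_nonneg_left h2 hy.le
    rwa [mul_inv_cancel₀ hy.ne'] at this
  have hL := abs_laguerreNeg_sub_le hy.le (by positivity) h1 hnq hsq hyq hs0
  rw [← hM] at hL
  set B := besselInt (2 * s) with hBd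
  have hB0 : 0 < B := besselInt_pos _
  set u := Real.exp (y / 2) * (2 * π * laguerreNeg n y) / B - 1 with hu
  set v := B / (2 * π) * (√(2 * π * (2 * s)) * Real.exp (-(2 * s))) - 1 with hv
  have hst : (2 * s)⁻¹ = t / (2 * √y) := by
    rw [hs, htd]; field_simp
  have hub : |u| ≤ c₁ * t := by
    have e : u = Real.exp (y / 2) / B *
        (2 * π * laguerreNeg n y - Real.exp (-(y / 2)) * B) := by
      rw [hu, Real.exp_neg]
      have := Real.exp_pos (y / 2)
      field_simp
    rw [e, abs_mul, abs_of_pos (by positivity)]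
    calc _ ≤ Real.exp (y / 2) / B * (B * (Real.exp (y / 2) * (2 * (y * q)) + M / (2 * s))) := by
          gcongr
      _ = c₁ * t := by
          rw [div_eq_mul_inv M, hst, hq, hc₁]; field_simp
  have hvb : |v| ≤ c₂ * t := by
    refine (hB (2 * s) (by positivity)).trans (le_of_eq ?_)
    rw [div_eq_mul_inv, hst, hc₂]; ring
  have e : Real.exp (y / 2) * laguerreNeg n y * (√(2 * π * (2 * s)) * Real.exp (-(2 * s))) - 1 =
      u + v + u * v := by
    have : Real.exp (y / 2) * laguerreNeg n y * (√(2 * π * (2 * s)) * Real.exp (-(2 * s))) =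
        (1 + u) * (1 + v) := by
      rw [hu, hv]
      have := Real.pi_pos
      field_simp
      ring
    rw [this]; ring
  rw [e]
  have huv : |u * v| ≤ c₁ * c₂ * t := by
    rw [abs_mul]
    calc |u| * |v| ≤ (c₁ * t) * (c₂ * t) := mul_le_mul hub hvb (abs_nonneg _) (by positivity)
      _ = c₁ * c₂ * t * t := by ring
      _ ≤ c₁ * c₂ * t := mul_le_of_le_one_right (by positivity) ht1
  calc |u + v + u * v| ≤ |u| + |v| + |u * v| := abs_add_three _ _ _
    _ ≤ c₁ * t + c₂ * t + c₁ * c₂ * t := by linarith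
    _ = _ := by ring

theorem exists_laguerreNeg_asymptotic {a : ℝ} (ha : a ≠ 0) :
    ∃ r : ℕ → ℝ, r =O[atTop] (fun k : ℕ => (k : ℝ) ^ (-(1 / 2) : ℝ)) ∧
      ∀ k : ℕ, 1 ≤ k → Real.exp (a ^ 2) * laguerreNeg k (2 * a ^ 2) =
        1 / (2 * (2 * (k : ℝ)) ^ (1 / 4 : ℝ) * √(|a| * π)) *
          Real.exp ((2 : ℝ) ^ (3 / 2 : ℝ) * |a| * √(k : ℝ)) * (1 + r k) := by
  set y := 2 * a ^ 2 with hy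
  have hy0 : 0 < y := by positivity
  have hya : √y = √2 * |a| := by rw [hy, Real.sqrt_mul zero_le_two, Real.sqrt_sq_eq_abs]
  have hay : a ^ 2 = y / 2 := by rw [hy]; ring
  -- The error is defined as the exact ratio minus 1, so the identity is algebraic. It needs `k ≥
  -- 1`, because the prefactor degenerates at `k = 0`.
  refine ⟨fun n => Real.exp (y / 2) * laguerreNeg n y *
      (√(2 * π * (2 * (√n * √y))) * Real.exp (-(2 * (√n * √y)))) - 1, ?_, fun k hk => ?_⟩
  · obtain ⟨C, hC⟩ := exists_abs_laguerre_ratio_sub_one_le hy0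
    refine IsBigO.of_bound C ?_
    filter_upwards [hC] with n hn
    rw [Real.norm_eq_abs, Real.norm_eq_abs, abs_of_nonneg (by positivity : 0 ≤ (n : ℝ) ^ (-(1 / 2) : ℝ)),
      Real.rpow_neg (by positivity), ← Real.sqrt_eq_rpow]
    exact hn
  · have hk0 : (0 : ℝ) < k := by exact_mod_cast hk
    have h32 : (2 : ℝ) ^ (3 / 2 : ℝ) = 2 * √2 := by
      rw [show (3 / 2 : ℝ) = 1 + 1 / 2 by norm_num, Real.rpow_add two_pos, Real.rpow_one,
        Real.sqrt_eq_rpow]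
    have e1 : (2 : ℝ) ^ (3 / 2 : ℝ) * |a| * √(k : ℝ) = 2 * (√k * √y) := by rw [h32, hya]; ring
    have e2 : 2 * (2 * (k : ℝ)) ^ (1 / 4 : ℝ) * √(|a| * π) = √(2 * π * (2 * (√k * √y))) := by
      have h4 : ((2 * (k : ℝ)) ^ (1 / 4 : ℝ)) = √(√(2 * k)) := by
        rw [Real.sqrt_eq_rpow, Real.sqrt_eq_rpow, ← Real.rpow_mul (by positivity)]; norm_num
      have h2 : (2 : ℝ) = √4 := by
        rw [show (4 : ℝ) = 2 ^ 2 by norm_num, Real.sqrt_sq zero_le_two]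
      rw [h4]
      nth_rewrite 1 [h2]
      rw [← Real.sqrt_mul (by norm_num), ← Real.sqrt_mul (by positivity), Real.sqrt_mul zero_le_two,
        hya]
      congr 1
      ring
    rw [e1, e2, hay, add_sub_cancel, Real.exp_neg]
    have hp : 0 < √(2 * π * (2 * (√k * √y))) := by positivity
    have hE := Real.exp_pos (2 * (√k * √y))
    field_simp

/-- After taking logarithms the prefactor contributes a constant and `(log k)/4`, both negligible
against `√k`. Eventually `r k > -1`, so the logarithm splits. -/
theorem tendsto_log_div_sqrt {N r : ℕ → ℝ} {c d : ℝ} (hc : 0 < c)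
    (hr : r =O[atTop] (fun k : ℕ => (k : ℝ) ^ (-(1 / 2) : ℝ)))
    (h : ∀ k : ℕ, 1 ≤ k → N k = 1 / (2 * (2 * (k : ℝ)) ^ (1 / 4 : ℝ) * c) *
      Real.exp (d * √(k : ℝ)) * (1 + r k)) :
    Tendsto (fun k : ℕ => 1 / √(k : ℝ) * Real.log (N k)) atTop (𝓝 d) := by
  have hcast : Tendsto (fun k : ℕ => (k : ℝ)) atTop atTop := tendsto_natCast_atTop_atTop
  have hr0 : Tendsto r atTop (𝓝 0) :=
    hr.trans_tendsto ((tendsto_rpow_neg_atTop (by norm_num)).comp hcast)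
  have hinv : Tendsto (fun k : ℕ => 1 / √(k : ℝ)) atTop (𝓝 0) := by
    simp only [one_div]
    exact tendsto_inv_atTop_zero.comp (Real.tendsto_sqrt_atTop.comp hcast)
  have hlog1 : Tendsto (fun k => Real.log (1 + r k)) atTop (𝓝 0) := by
    have h1 : Tendsto (fun k => 1 + r k) atTop (𝓝 1) := by simpa using hr0.const_add 1
    simpa using h1.log one_ne_zero
  have hlogk : Tendsto (fun k : ℕ => 1 / √(k : ℝ) * Real.log k) atTop (𝓝 0) := by
    have h1 := (isLittleO_log_rpow_atTop (r := 1 / 2) (by norm_num)).tendsto_div_nhds_zero.comp hcast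
    refine h1.congr fun k => ?_
    rw [Function.comp, Real.sqrt_eq_rpow]; ring
  have hlim : Tendsto (fun k : ℕ => d + (1 / √(k : ℝ) * Real.log (1 + r k) -
      (1 / √(k : ℝ)) * (Real.log (2 * c) + 1 / 4 * Real.log 2) -
      1 / 4 * (1 / √(k : ℝ) * Real.log k))) atTop (𝓝 d) := by
    have := (((hinv.mul hlog1).sub (hinv.mul_const (Real.log (2 * c) + 1 / 4 * Real.log 2))).sub
      (hlogk.const_mul (1 / 4))).const_add d
    simpa using this
  refine hlim.congr' ?_
  filter_upwards [eventually_ge_atTop 1,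
    hr0.eventually (lt_mem_nhds (show (-1 : ℝ) < 0 by norm_num))] with k hk hrk
  have hk0 : (0 : ℝ) < k := by exact_mod_cast hk
  have hs : 0 < √(k : ℝ) := Real.sqrt_pos.2 hk0
  have hr1 : 0 < 1 + r k := by linarith
  have hlogN : Real.log (N k) = d * √(k : ℝ) + Real.log (1 + r k) -
      (Real.log (2 * c) + 1 / 4 * (Real.log 2 + Real.log k)) := by
    have e : 2 * (2 * (k : ℝ)) ^ (1 / 4 : ℝ) * c = (2 * c) * (2 * (k : ℝ)) ^ (1 / 4 : ℝ) := by ring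
    rw [h k hk, Real.log_mul (by positivity) hr1.ne', Real.log_mul (by positivity) (by positivity),
      Real.log_exp, one_div, Real.log_inv, e, Real.log_mul (by positivity) (by positivity),
      Real.log_rpow (by positivity), Real.log_mul two_ne_zero hk0.ne']
    ring
  rw [hlogN]
  field_simp
  ring

end NSAOsc

theorem theorem1 (a : ℝ) (ha : a ≠ 0)
    (A : NSAOsc.L2R →ₗ.[ℂ] NSAOsc.L2R) (hA : A = NSAOsc.oscL a ∨ A = NSAOsc.oscLTilde a) :
    ∃ P : ℕ → (NSAOsc.L2R →L[ℂ] NSAOsc.L2R),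
      -- each `1 + 2k + a²` is a simple eigenvalue, with the unique spectral projection `P k`
      (∀ k, NSAOsc.IsEigenvalue A (NSAOsc.eigenval a k) ∧
        (∀ Q, NSAOsc.IsSpectralProjection A (NSAOsc.eigenval a k) Q ↔ Q = P k) ∧
        Module.finrank ℂ (P k).range = 1) ∧
      (∃ r : ℕ → ℝ, r =O[atTop] (fun k : ℕ => (k : ℝ) ^ (-(1 / 2) : ℝ)) ∧
        ∀ k : ℕ, 1 ≤ k →
          ‖P k‖ = 1 / (2 * (2 * (k : ℝ)) ^ (1 / 4 : ℝ) * √(|a| * π)) *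
            Real.exp ((2 : ℝ) ^ (3 / 2 : ℝ) * |a| * √(k : ℝ)) * (1 + r k)) ∧
      Tendsto (fun k : ℕ => 1 / √(k : ℝ) * Real.log ‖P k‖) atTop
        (𝓝 ((2 : ℝ) ^ (3 / 2 : ℝ) * |a|)) := by
  obtain ⟨P, hP, hnorm⟩ := NSAOsc.exists_spectralProjections hA
  obtain ⟨r, hr, hform⟩ := NSAOsc.exists_laguerreNeg_asymptotic ha
  have h : ∀ k : ℕ, 1 ≤ k → ‖P k‖ = 1 / (2 * (2 * (k : ℝ)) ^ (1 / 4 : ℝ) * √(|a| * π)) *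
      Real.exp ((2 : ℝ) ^ (3 / 2 : ℝ) * |a| * √(k : ℝ)) * (1 + r k) := fun k hk => by
    rw [hnorm, hform k hk]
  exact ⟨P, hP, ⟨r, hr, h⟩, NSAOsc.tendsto_log_div_sqrt
    (Real.sqrt_pos.2 (mul_pos (abs_pos.2 ha) Real.pi_pos)) hr h⟩
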